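/- Let $n\ge 1$ and let $\mathbb H_n=\mathbb C^n\times\mathbb R$ be the Heisenberg group with law $(z,\tau)\circ(w,s)=(z+w,\ \tau+s+2\,\mathrm{Im}\langle z,w\rangle)$, where $\langle z,w\rangle=\sum_j z_j\overline{w_j}$, $|z|^2=\langle z,z\rangle$, with Lebesgue measure $d\nu$ and homogeneous norm $|(u,t)|=(|u|^4+t^2)^{1/4}$. Let $$\Delta_{\mathbb H_n}=\sum_{j=1}^n\Big[-\frac{\partial^2}{\partial z_j\partial\bar z_j}-|z_j|^2\frac{\partial^2}{\partial\tau^2}+i\frac{\partial}{\partial\tau}\Big(z_j\frac{\partial}{\partial z_j}-\bar z_j\frac{\partial}{\partial\bar z_j}\Big)\Big],$$ $$c_n=\Big[n(n+2)\int_{\mathbb H_n}|u|^2\,(|u|^4+t^2+1)^{-\frac{n+4}{2}}\,d\nu(u,t)\Big]^{-1},\qquad G_0^F(u,t)=c_n\,|(u,t)|^{-2n}.$$ Let $\Psi$ be Tricomi's function, $\Psi(a,c;u)=\frac1{\Gamma(a)}\int_0^\infty e^{-ut}t^{a-1}(1+t)^{c-a-1}\,dt$ for $\mathrm{Re}\,a>0$,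 $u>0$, and for $\mathrm{Re}\,\zeta\le 0$ and $z\neq w$ let $$\mathcal R(\zeta;(z,\tau),(w,s))=-\frac{2^n}{\pi^{n+1/2}}\int_0^\infty x^{n-1}\,\Gamma\Big(\frac n2-\frac{\zeta}{2x}\Big)\Psi\Big(\frac n2-\frac{\zeta}{2x},n;2x|z-w|^2\Big)e^{-x|z-w|^2}\cos\big(x(\tau-s)+2x\,\mathrm{Im}\langle z,w\rangle\big)\,dx$$ (the resolvent kernel of $\Delta_{\mathbb H_n}$, up to a positive constant factor). Then: 1. $c_n=2^{n-2}\,\Gamma(n/2)^2/\pi^{n+1}$, and $G_0^F$ is a fundamental solution of $\Delta_{\mathbb H_n}$ with source at the origin: for every $\phi\in C_0^\infty(\mathbb H_n)$ the function $\Delta_{\mathbb H_n}\phi\cdot G_0^F$ is integrable and $\int_{\mathbb H_n}\Delta_{\mathbb H_n}\phi\; G_0^F\,d\nu=\phi(0)$. 2. For all $(z,\tau),(w,s)\in\mathbb H_n$ with $z\ne w$, the integral defining $\mathcal R(\zeta;\cdot,\cdot)$ converges absolutely for every $\zeta$ with $\mathrm{Re}\,\zeta\le0$; $\mathcal R(\zeta;(z,\tau),(w,s))\to\mathcal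 R(0;(z,\tau),(w,s))$ as $\zeta\to0$ with $\mathrm{Re}\,\zeta<0$; and $$-\mathcal R(0;(z,\tau),(w,s))=\frac{2^{n-1}\Gamma(n/2)^2}{\pi^{n+1/2}}\Big(|z-w|^4+\big(\tau-s+2\,\mathrm{Im}\langle z,w\rangle\big)^2\Big)^{-n/2}$$ $$=\frac{2^{n-1}\Gamma(n/2)^2}{\pi^{n+1/2}\,c_n}\,G_0^F\big((w,s)^{-1}\circ(z,\tau)\big)=2\sqrt\pi\;G_0^F\big((w,s)^{-1}\circ(z,\tau)\big).$$ 3. Consequently, for all $(z,\tau)\in\mathbb H_n$ with $z\neq0$, $$G_0^F(z,\tau)=\pi^{-n-1}\,2^{n-1}\,\Gamma\Big(\frac n2\Big)\int_0^\infty x^{n-1}e^{-x|z|^2}\,\Psi\Big(\frac n2,n;2x|z|^2\Big)\cos(\tau x)\,dx,$$ the integral being absolutely convergent. -/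

import Mathlib

open MeasureTheory Set Filter Topology
open scoped ContDiff

noncomputable section

namespace Heisenberg

/-- The underlying manifold `ℂⁿ × ℝ` of the Heisenberg group, with points `(z, τ)`.  Its
`volume` is Lebesgue measure on `ℝ²ⁿ⁺¹`. -/
abbrev Pt (n : ℕ) : Type := (Fin n → ℂ) × ℝ

/-- `⟨z, w⟩ = ∑ j, z j * conj (w j)`. -/
def herm {n : ℕ} (z w : Fin n → ℂ) : ℂ := ∑ j, z j * (starRingEnd ℂ) (w j)

/-- `|z|² = ∑ j, |z j|²`, the squared Euclidean norm on `ℂⁿ`. -/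
def sqNorm {n : ℕ} (z : Fin n → ℂ) : ℝ := ∑ j, ‖z j‖ ^ 2

/-- The group law `(z, τ) ∘ (w, s) = (z + w, τ + s + 2 Im ⟨z, w⟩)`. -/
def mul {n : ℕ} (p q : Pt n) : Pt n := (p.1 + q.1, p.2 + q.2 + 2 * (herm p.1 q.1).im)

/-- The inverse `(z, τ)⁻¹ = (-z, -τ)` for the group law. -/
def inv {n : ℕ} (p : Pt n) : Pt n := (-p.1, -p.2)

/-- The homogeneous norm `|(u, t)| = (|u|⁴ + t²)^(1/4)`. -/
def homNorm {n : ℕ} (p : Pt n) : ℝ := (sqNorm p.1 ^ 2 + p.2 ^ 2) ^ (1 / 4 : ℝ)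

/-- `∂/∂x_j`, where `z_j = x_j + i y_j`. -/
def partialX {n : ℕ} (j : Fin n) (f : Pt n → ℂ) (p : Pt n) : ℂ :=
  fderiv ℝ f p (Pi.single j 1, 0)

/-- `∂/∂y_j`, where `z_j = x_j + i y_j`. -/
def partialY {n : ℕ} (j : Fin n) (f : Pt n → ℂ) (p : Pt n) : ℂ :=
  fderiv ℝ f p (Pi.single j Complex.I, 0)

/-- `∂/∂τ`. -/
def partialT {n : ℕ} (f : Pt n → ℂ) (p : Pt n) : ℂ := fderiv ℝ f p (0, 1)

/-- `∂/∂z_j = (∂/∂x_j - i ∂/∂y_j) / 2`. -/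
def partialZ {n : ℕ} (j : Fin n) (f : Pt n → ℂ) (p : Pt n) : ℂ :=
  (1 / 2) * (partialX j f p - Complex.I * partialY j f p)

/-- `∂/∂z̄_j = (∂/∂x_j + i ∂/∂y_j) / 2`. -/
def partialZbar {n : ℕ} (j : Fin n) (f : Pt n → ℂ) (p : Pt n) : ℂ :=
  (1 / 2) * (partialX j f p + Complex.I * partialY j f p)

/-- The sub-Laplacian
`∑ j, [-∂²/∂z_j∂z̄_j - |z_j|² ∂²/∂τ² + i ∂/∂τ (z_j ∂/∂z_j - z̄_j ∂/∂z̄_j)]`. -/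
def subLaplacian {n : ℕ} (f : Pt n → ℂ) (p : Pt n) : ℂ :=
  ∑ j, (-partialZ j (partialZbar j f) p
    - ((‖p.1 j‖ ^ 2 : ℝ) : ℂ) * partialT (partialT f) p
    + Complex.I * partialT (fun q => q.1 j * partialZ j f q
        - (starRingEnd ℂ) (q.1 j) * partialZbar j f q) p)

/-- Folland's constant
`c_n = [n (n + 2) ∫ |u|² (|u|⁴ + t² + 1)^(-(n + 4) / 2) du dt]⁻¹`. -/
def follandConst (n : ℕ) : ℝ :=
  ((n : ℝ) * ((n : ℝ) + 2) *
    ∫ p : Pt n, sqNorm p.1 * (sqNorm p.1 ^ 2 + p.2 ^ 2 + 1) ^ (-((n : ℝ) + 4) / 2))⁻¹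

/-- `G(u, t) = c_n |(u, t)|^(-2n)` (the value given to the singular point `0` is immaterial). -/
def follandG {n : ℕ} (p : Pt n) : ℝ := follandConst n * homNorm p ^ (-(2 * (n : ℝ)))

/-- Tricomi's confluent hypergeometric function `Ψ(a, c; u)`, for `Re a > 0` and `u > 0`:
`Ψ(a, c; u) = Γ(a)⁻¹ ∫₀^∞ e^(-u t) t^(a - 1) (1 + t)^(c - a - 1) dt`. -/
def tricomiPsi (a c : ℂ) (u : ℝ) : ℂ :=
  (Complex.Gamma a)⁻¹ *
    ∫ t in Ioi (0 : ℝ), (Real.exp (-(u * t)) : ℂ) * (t : ℂ) ^ (a - 1)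
      * ((1 + t : ℝ) : ℂ) ^ (c - a - 1)

/-- The integrand, in `x > 0`, of the resolvent kernel. -/
def resolventIntegrand {n : ℕ} (ζ : ℂ) (p q : Pt n) (x : ℝ) : ℂ :=
  (x : ℂ) ^ (n - 1) * Complex.Gamma ((n : ℂ) / 2 - ζ / (2 * x))
    * tricomiPsi ((n : ℂ) / 2 - ζ / (2 * x)) n (2 * x * sqNorm (p.1 - q.1))
    * (Real.exp (-(x * sqNorm (p.1 - q.1))) : ℂ)
    * (Real.cos (x * (p.2 - q.2) + 2 * x * (herm p.1 q.1).im) : ℂ)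

/-- The resolvent kernel `R(ζ; (z, τ), (w, s))` of the sub-Laplacian, for `Re ζ ≤ 0` and `z ≠ w`,
as an integral of `Ψ`-functions, in the normalization with the prefactor `-2ⁿ π^(-n - 1/2)`. -/
def resolventKernel {n : ℕ} (ζ : ℂ) (p q : Pt n) : ℂ :=
  -((2 ^ n * Real.pi ^ (-(n : ℝ) - 1 / 2) : ℝ) : ℂ)
    * ∫ x in Ioi (0 : ℝ), resolventIntegrand ζ p q x

end Heisenberg

end

namespace Heisenberg

/-! Two independent computations are matched through the closed form of `follandConst`.

Resolvent side. Put S = |z-w|² and T = τ-s+2 Im⟨z,w⟩. The Laplace integral of Ψ cancels the factor Γ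
and leaves a double integral over x, t > 0. At ζ = 0 the substitution p = xt, q = x(1+t), with
Jacobian -x, p+q = x(1+2t) and q-p = x, turns it into the integral of (pq)^(n/2-1) e^(-S(p+q))
cos((q-p)T) over the wedge 0 < p < q. This integrand is symmetric, so the wedge carries half of the
integral over the quadrant (`integral_wedgeMap`). Over the quadrant the variables separate: the
integral is the squared modulus of ∫ p^(n/2-1) e^(-(S+iT)p) dp, that is Γ(n/2)² (S²+T²)^(-n/2)
(`integral_quadrantKernel`). For Re ζ ≤ 0 the only new factor is (t/(1+t))^(-ζ/(2x)), of modulus at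
most 1, so the kernel with ζ = 0 and T = 0 is a majorant independent of ζ (`norm_doubleKernel_le`).
It gives absolute convergence, Fubini and the limit ζ → 0.

Fundamental solution. Replace |z|⁴+t² by the smooth positive gauge |z|⁴+t²+ε⁴. Integration by parts
moves the sub-Laplacian from φ to the power -n/2 of this gauge, and the result is n(n+2)|z|² ε⁴
times its power -(n+4)/2 (`integral_subLaplacian_mul_regPow`). The dilation (εz, ε²t) turns that
into a fixed density tested against φ(εz, ε²t) (`integral_mul_regPow_eq_dilation`), which tends to
φ(0) times the total mass of the density, namely 1/c_n. On the other side the regularization is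
removed by dominated convergence.

The constant. Integrating in t and then in polar coordinates reduces c_n to Gamma values, and the
duplication formula gives the closed form (`follandConst_eq`). -/

/-! ### The Laplace transform of p^(n/2-1) at a complex parameter. -/

/-- The Gaussian integral on ℝⁿ with complex parameter, written in polar coordinates, is a constant
times this integral. The case b = 1 fixes the modulus of the constant. Only the modulus is needed
later. -/
theorem norm_integral_rpow_mul_cexp_neg_mul_Ioi {n : ℕ} (hn : 1 ≤ n) {b : ℂ} (hb : 0 < b.re) :
    ‖∫ p in Ioi (0 : ℝ), ((p ^ ((n : ℝ) / 2 - 1) : ℝ) : ℂ) * Complex.exp (-(b * p))‖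
      = Real.Gamma ((n : ℝ) / 2) * ‖b‖ ^ (-((n : ℝ) / 2)) := by
  have : NeZero n := ⟨by omega⟩
  have hn' : (0 : ℝ) < n := by exact_mod_cast hn
  set V := EuclideanSpace ℝ (Fin n)
  set H : ℂ → ℂ := fun b =>
    ∫ p in Ioi (0 : ℝ), ((p ^ ((n : ℝ) / 2 - 1) : ℝ) : ℂ) * Complex.exp (-(b * p)) with hH
  -- Polar coordinates, then p = y²: the factor y (y²)^(n/2-1) is exactly the radial weight y^(n-1).
  have key : ∀ b : ℂ, 0 < b.re → (Real.pi / b : ℂ) ^ ((n : ℂ) / 2) =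
      (n * (volume : Measure V).real (Metric.ball 0 1) / 2 : ℝ) * H b := by
    intro b hb
    have h1 := GaussianFourier.integral_cexp_neg_mul_sq_norm (V := V) hb
    have h2 := integral_fun_norm_addHaar (volume : Measure V)
      (fun y : ℝ => Complex.exp (-b * (y : ℂ) ^ 2))
    rw [h1] at h2
    have h3 := integral_comp_rpow_Ioi
      (fun p : ℝ => ((p ^ ((n : ℝ) / 2 - 1) : ℝ) : ℂ) * Complex.exp (-(b * p)))
      (p := 2) (by norm_num)
    have h4 : H b = 2 * ∫ y in Ioi (0 : ℝ), y ^ (n - 1) • Complex.exp (-b * (y : ℂ) ^ 2) := by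
      rw [hH]
      dsimp only
      rw [← h3, ← integral_const_mul]
      refine setIntegral_congr_fun measurableSet_Ioi fun y hy => ?_
      have hy : 0 < y := hy
      have e1 : (y : ℝ) ^ (2 : ℝ) = y ^ 2 := by norm_cast
      have e2 : y ^ ((2 : ℝ) - 1) * (y ^ 2) ^ ((n : ℝ) / 2 - 1) = y ^ (n - 1) := by
        rw [← e1, ← Real.rpow_mul hy.le, ← Real.rpow_add hy, ← Real.rpow_natCast]
        congr 1
        rw [Nat.cast_sub hn]
        push_cast; ring
      simp only [Complex.real_smul]
      rw [e1, ← e2]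
      push_cast
      simp
      ring_nf
    rw [h4]
    simp only [V, finrank_euclideanSpace, Fintype.card_fin, Complex.real_smul, nsmul_eq_mul] at h2
    rw [h2]
    push_cast
    simp only [Complex.real_smul]
    push_cast
    ring
  have h1 := key 1 (by simp)
  have hg : H 1 = (Real.Gamma ((n : ℝ) / 2) : ℂ) := by
    rw [Real.Gamma_eq_integral (by positivity), ← integral_complex_ofReal]
    refine setIntegral_congr_fun measurableSet_Ioi fun y hy => ?_
    simp [mul_comm]
  have h2 := key b hb
  set A : ℝ := n * (volume : Measure V).real (Metric.ball 0 1) / 2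
  have hc : ((n : ℂ) / 2) = (((n : ℝ) / 2 : ℝ) : ℂ) := by push_cast; rfl
  have hb0 : 0 < ‖b‖ := norm_pos_iff.2 fun h => by simp [h] at hb
  have h1' := congrArg norm h1
  have h2' := congrArg norm h2
  have hΓ : 0 < Real.Gamma ((n : ℝ) / 2) := Real.Gamma_pos_of_pos (by positivity)
  have hpi := Real.pi_pos
  rw [hc, Complex.norm_cpow_real, hg, norm_mul, Complex.norm_real, Complex.norm_real,
    Real.norm_of_nonneg hΓ.le, div_one, Complex.norm_real, Real.norm_of_nonneg hpi.le] at h1'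
  rw [hc, Complex.norm_cpow_real, norm_mul, Complex.norm_real, norm_div, Complex.norm_real,
    Real.norm_of_nonneg hpi.le, Real.div_rpow hpi.le hb0.le, h1'] at h2'
  -- The case b = 1 reads π^(n/2) = ‖A‖ Γ(n/2), so the volume of the ball never has to be computed.
  have hA : ‖A‖ ≠ 0 := by
    intro h
    rw [h, zero_mul] at h1'
    exact (Real.rpow_pos_of_pos hpi _).ne' h1'
  change ‖H b‖ = _
  rw [Real.rpow_neg hb0.le]
  apply mul_left_cancel₀ hA
  rw [← h2']
  field_simp

/-! ### The change of variables between the quadrant and the wedge 0 < p < q. -/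

/-- The map `(x, t) ↦ (x t, x (1 + t))`. -/
noncomputable def wedgeMap (v : ℝ × ℝ) : ℝ × ℝ := (v.1 * v.2, v.1 + v.1 * v.2)

noncomputable def wedgeMapDeriv (v : ℝ × ℝ) : ℝ × ℝ →L[ℝ] ℝ × ℝ :=
  (Matrix.toLin (.finTwoProd ℝ) (.finTwoProd ℝ)
    !![v.2, v.1; 1 + v.2, v.1]).toContinuousLinearMap

theorem hasFDerivAt_wedgeMap (v : ℝ × ℝ) : HasFDerivAt wedgeMap (wedgeMapDeriv v) v := by
  unfold wedgeMapDeriv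
  rw [Matrix.toLin_finTwoProd_toContinuousLinearMap]
  have h := (hasFDerivAt_fst (𝕜 := ℝ) (p := v)).mul (hasFDerivAt_snd (𝕜 := ℝ) (p := v))
  convert! h.prodMk ((hasFDerivAt_fst (𝕜 := ℝ) (p := v)).add h) using 2
  · simp [add_comm]
  · ext <;> simp [add_comm]

theorem det_wedgeMapDeriv (v : ℝ × ℝ) : (wedgeMapDeriv v).det = -v.1 := by
  unfold wedgeMapDeriv
  simp only [LinearMap.det_toContinuousLinearMap, LinearMap.det_toLin, Matrix.det_fin_two_of]
  ring

theorem wedgeMap_injOn : InjOn wedgeMap (Ioi 0 ×ˢ Ioi 0) := by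
  rintro ⟨x, t⟩ ⟨hx, -⟩ ⟨y, s⟩ - h
  simp only [wedgeMap, Prod.mk.injEq, mem_Ioi] at h hx ⊢
  have : x = y := by linarith [h.1, h.2]
  subst this
  exact ⟨rfl, mul_left_cancel₀ hx.ne' h.1⟩

theorem wedgeMap_image : wedgeMap '' (Ioi 0 ×ˢ Ioi 0) = {v : ℝ × ℝ | 0 < v.1 ∧ v.1 < v.2} := by
  ext ⟨p, q⟩
  simp only [mem_image, mem_ofPred_eq, Prod.exists, mem_prod, mem_Ioi, wedgeMap, Prod.mk.injEq]
  constructor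
  · rintro ⟨x, t, ⟨hx, ht⟩, rfl, rfl⟩
    exact ⟨by positivity, by linarith⟩
  · rintro ⟨hp, hq⟩
    have : 0 < q - p := by linarith
    refine ⟨q - p, p / (q - p), ⟨this, by positivity⟩, by field_simp, by field_simp; ring⟩

theorem measurableSet_quadrant : MeasurableSet (Ioi (0 : ℝ) ×ˢ Ioi (0 : ℝ)) :=
  measurableSet_Ioi.prod measurableSet_Ioi

theorem integrableOn_wedgeMap {f : ℝ × ℝ → ℝ}
    (hf : IntegrableOn f (Ioi 0 ×ˢ Ioi 0)) :
    IntegrableOn (fun v : ℝ × ℝ => v.1 * f (wedgeMap v)) (Ioi 0 ×ˢ Ioi 0) := by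
  have := (integrableOn_image_iff_integrableOn_abs_det_fderiv_smul volume measurableSet_quadrant
    (fun v _ => (hasFDerivAt_wedgeMap v).hasFDerivWithinAt) wedgeMap_injOn f).1
    (hf.mono_set (by
      rw [wedgeMap_image]
      exact fun v hv => ⟨hv.1, hv.1.trans hv.2⟩))
  refine this.congr_fun (fun v hv => ?_) measurableSet_quadrant
  simp [det_wedgeMapDeriv, abs_of_pos (show 0 < v.1 from hv.1)]

/-- The quadrant is the disjoint union of the wedge, its mirror image and a null diagonal; by
symmetry each wedge contributes the same amount. -/
theorem integral_wedgeMap {f : ℝ × ℝ → ℝ} (hf : IntegrableOn f (Ioi 0 ×ˢ Ioi 0))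
    (hsymm : ∀ v, f v.swap = f v) :
    ∫ v in Ioi (0 : ℝ) ×ˢ Ioi (0 : ℝ), v.1 * f (wedgeMap v)
      = (∫ v in Ioi (0 : ℝ) ×ˢ Ioi (0 : ℝ), f v) / 2 := by
  have h1 := integral_image_eq_integral_abs_det_fderiv_smul volume measurableSet_quadrant
    (fun v _ => (hasFDerivAt_wedgeMap v).hasFDerivWithinAt) wedgeMap_injOn f
  rw [wedgeMap_image] at h1
  have h2 : ∫ v in Ioi (0 : ℝ) ×ˢ Ioi (0 : ℝ), v.1 * f (wedgeMap v)
      = ∫ v in {v : ℝ × ℝ | 0 < v.1 ∧ v.1 < v.2}, f v := by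
    rw [h1]
    refine setIntegral_congr_fun measurableSet_quadrant fun v hv => ?_
    simp [det_wedgeMapDeriv, abs_of_pos (show 0 < v.1 from hv.1)]
  have hmp : MeasurePreserving (Prod.swap : ℝ × ℝ → ℝ × ℝ) := Measure.measurePreserving_swap
  have h3 : ∫ v in {v : ℝ × ℝ | 0 < v.2 ∧ v.2 < v.1}, f v
      = ∫ v in {v : ℝ × ℝ | 0 < v.1 ∧ v.1 < v.2}, f v := by
    rw [← hmp.setIntegral_preimage_emb MeasurableEquiv.prodComm.measurableEmbedding]
    simp only [hsymm]
    rfl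
  have hm : MeasurableSet {v : ℝ × ℝ | 0 < v.1 ∧ v.1 < v.2} :=
    (measurableSet_lt measurable_const measurable_fst).inter
      (measurableSet_lt measurable_fst measurable_snd)
  have hm' : MeasurableSet {v : ℝ × ℝ | 0 < v.2 ∧ v.2 < v.1} :=
    (measurableSet_lt measurable_const measurable_snd).inter
      (measurableSet_lt measurable_snd measurable_fst)
  have hdiag : (volume : Measure (ℝ × ℝ)) {v | v.1 = v.2} = 0 := by
    have hm0 : MeasurableSet {v : ℝ × ℝ | v.1 = v.2} :=
      measurableSet_eq_fun measurable_fst measurable_snd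
    rw [Measure.volume_eq_prod, Measure.measure_prod_null hm0]
    filter_upwards with x
    have : Prod.mk x ⁻¹' {v : ℝ × ℝ | v.1 = v.2} = {x} := by ext y; simp [eq_comm]
    simp [this]
  have h4 : (Ioi (0 : ℝ) ×ˢ Ioi (0 : ℝ) : Set (ℝ × ℝ)) =ᵐ[volume]
      ({v : ℝ × ℝ | 0 < v.1 ∧ v.1 < v.2} ∪ {v : ℝ × ℝ | 0 < v.2 ∧ v.2 < v.1} : Set (ℝ × ℝ)) := by
    have : ∀ᵐ v : ℝ × ℝ, v.1 ≠ v.2 := by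
      rw [ae_iff]; simpa using hdiag
    filter_upwards [this] with v hv
    refine propext ?_
    change (0 < v.1 ∧ 0 < v.2) ↔ (0 < v.1 ∧ v.1 < v.2) ∨ (0 < v.2 ∧ v.2 < v.1)
    constructor
    · rintro ⟨h, h'⟩
      rcases lt_or_gt_of_ne hv with h0 | h0
      · exact Or.inl ⟨h, h0⟩
      · exact Or.inr ⟨h', h0⟩
    · rintro (⟨h, h'⟩ | ⟨h, h'⟩)
      · exact ⟨h, h.trans h'⟩
      · exact ⟨h.trans h', h⟩
  rw [h2, setIntegral_congr_set h4, setIntegral_union _ hm'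
    (hf.mono_set fun v hv => ⟨hv.1, hv.1.trans hv.2⟩)
    (hf.mono_set fun v hv => ⟨hv.1.trans hv.2, hv.1⟩), h3]
  · ring
  · rw [Set.disjoint_left]
    rintro v ⟨-, h⟩ ⟨-, h'⟩
    exact lt_asymm h h'

/-! ### The closed form of the symmetric integral over the quadrant. -/

/-- A symmetric function on the quadrant whose pull-back by `wedgeMap` is the double-integral
kernel behind the resolvent at `ζ = 0`. -/
noncomputable def quadrantKernel (n : ℕ) (S T : ℝ) (v : ℝ × ℝ) : ℝ :=
  v.1 ^ ((n : ℝ) / 2 - 1) * v.2 ^ ((n : ℝ) / 2 - 1) * Real.exp (-(S * (v.1 + v.2)))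
    * Real.cos ((v.2 - v.1) * T)

theorem quadrantKernel_swap (n : ℕ) (S T : ℝ) (v : ℝ × ℝ) :
    quadrantKernel n S T v.swap = quadrantKernel n S T v := by
  have : (v.1 - v.2) * T = -((v.2 - v.1) * T) := by ring
  simp only [quadrantKernel, Prod.fst_swap, Prod.snd_swap]
  rw [this, Real.cos_neg, add_comm v.2, mul_comm (v.2 ^ _)]

theorem integrableOn_rpow_mul_cexp_neg_mul_Ioi {n : ℕ} (hn : 1 ≤ n) {b : ℂ} (hb : 0 < b.re) :
    IntegrableOn (fun p : ℝ => ((p ^ ((n : ℝ) / 2 - 1) : ℝ) : ℂ) * Complex.exp (-(b * p)))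
      (Ioi 0) := by
  have hn' : (0 : ℝ) < n := by exact_mod_cast hn
  -- The integral of a non-integrable function is 0 by convention, whereas this one has nonzero
  -- modulus.
  refine not_imp_comm.1 integral_undef fun h => ?_
  have h1 := norm_integral_rpow_mul_cexp_neg_mul_Ioi hn hb
  rw [h, norm_zero] at h1
  have hb0 : 0 < ‖b‖ := norm_pos_iff.2 fun h => by simp [h] at hb
  have := Real.Gamma_pos_of_pos (show 0 < (n : ℝ) / 2 by positivity)
  have : 0 < Real.Gamma ((n : ℝ) / 2) * ‖b‖ ^ (-((n : ℝ) / 2)) := by positivity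
  exact this.ne h1

/-- This separates the variables: the double integral becomes the real part of I · conj I, where I
is the one-variable integral at b = S + iT. -/
theorem quadrantKernel_eq_re (n : ℕ) (S T : ℝ) (v : ℝ × ℝ) :
    quadrantKernel n S T v =
      RCLike.re ((((v.1 ^ ((n : ℝ) / 2 - 1) : ℝ) : ℂ) * Complex.exp (-((⟨S, T⟩ : ℂ) * v.1)))
        * (starRingEnd ℂ) (((v.2 ^ ((n : ℝ) / 2 - 1) : ℝ) : ℂ)
          * Complex.exp (-((⟨S, T⟩ : ℂ) * v.2)))) := by
  rw [map_mul (starRingEnd ℂ), Complex.conj_ofReal, ← Complex.exp_conj, mul_mul_mul_comm, ← Complex.exp_add,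
    ← Complex.ofReal_mul]
  change _ = Complex.re _
  rw [Complex.re_ofReal_mul, Complex.exp_re]
  simp only [quadrantKernel]
  rw [mul_assoc]
  congr 2
  · simp; ring
  · congr 1; simp; ring

theorem integrableOn_quadrantKernel {n : ℕ} (hn : 1 ≤ n) {S : ℝ} (hS : 0 < S) (T : ℝ) :
    IntegrableOn (quadrantKernel n S T) (Ioi 0 ×ˢ Ioi 0) := by
  have h := integrableOn_rpow_mul_cexp_neg_mul_Ioi hn (b := ⟨S, T⟩) hS
  have h' := (LinearIsometryEquiv.integrable_comp_iff Complex.conjLIE).2 h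
  have h2 := (h.mul_prod h').re
  rw [Measure.prod_restrict, ← Measure.volume_eq_prod] at h2
  exact h2.congr (ae_of_all _ fun v => (quadrantKernel_eq_re n S T v).symm)

theorem integral_quadrantKernel {n : ℕ} (hn : 1 ≤ n) {S : ℝ} (hS : 0 < S) (T : ℝ) :
    ∫ v in Ioi (0 : ℝ) ×ˢ Ioi (0 : ℝ), quadrantKernel n S T v
      = Real.Gamma ((n : ℝ) / 2) ^ 2 * (S ^ 2 + T ^ 2) ^ (-(n : ℝ) / 2) := by
  have h := integrableOn_rpow_mul_cexp_neg_mul_Ioi hn (b := ⟨S, T⟩) hS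
  have h' := (LinearIsometryEquiv.integrable_comp_iff Complex.conjLIE).2 h
  have h2 := h.mul_prod h'
  rw [Measure.prod_restrict, ← Measure.volume_eq_prod] at h2
  simp only [quadrantKernel_eq_re]
  have h3 := integral_re h2
  have h4 := setIntegral_prod_mul (μ := (volume : Measure ℝ)) (ν := (volume : Measure ℝ))
    (fun p : ℝ => ((p ^ ((n : ℝ) / 2 - 1) : ℝ) : ℂ) * Complex.exp (-((⟨S, T⟩ : ℂ) * p)))
    (fun p : ℝ => (starRingEnd ℂ)
      (((p ^ ((n : ℝ) / 2 - 1) : ℝ) : ℂ) * Complex.exp (-((⟨S, T⟩ : ℂ) * p)))) (Ioi 0) (Ioi 0)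
  rw [← Measure.volume_eq_prod] at h4
  refine h3.trans ?_
  refine (congrArg RCLike.re h4).trans ?_
  rw [integral_conj, Complex.mul_conj, Complex.normSq_eq_norm_sq]
  simp only [RCLike.re_to_complex, Complex.ofReal_re]
  rw [norm_integral_rpow_mul_cexp_neg_mul_Ioi hn (b := ⟨S, T⟩) hS, mul_pow]
  congr 1
  have h0 : 0 < S ^ 2 + T ^ 2 := by positivity
  have : ‖(⟨S, T⟩ : ℂ)‖ = (S ^ 2 + T ^ 2) ^ (1 / 2 : ℝ) := by
    rw [← Real.sqrt_eq_rpow, Complex.norm_def, Complex.normSq_mk]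
    ring_nf
  rw [this, ← Real.rpow_mul h0.le, ← Real.rpow_natCast, ← Real.rpow_mul h0.le]
  congr 1
  push_cast; ring

theorem mul_quadrantKernel_wedgeMap {n : ℕ} (hn : 1 ≤ n) (S T : ℝ) {x t : ℝ} (hx : 0 < x)
    (ht : 0 < t) :
    x * quadrantKernel n S T (wedgeMap (x, t))
      = x ^ (n - 1) * (t ^ ((n : ℝ) / 2 - 1) * (1 + t) ^ ((n : ℝ) / 2 - 1))
        * Real.exp (-(x * S * (1 + 2 * t))) * Real.cos (x * T) := by
  have h1 : x * (x ^ ((n : ℝ) / 2 - 1) * x ^ ((n : ℝ) / 2 - 1)) = x ^ (n - 1) := by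
    rw [← Real.rpow_add hx, mul_comm, ← Real.rpow_add_one hx.ne', ← Real.rpow_natCast,
      Nat.cast_sub hn]
    congr 1; push_cast; ring
  simp only [quadrantKernel, wedgeMap]
  rw [show x + x * t = x * (1 + t) by ring, Real.mul_rpow hx.le ht.le,
    Real.mul_rpow hx.le (by positivity), ← h1]
  ring_nf

/-! ### The double integral for Re ζ ≤ 0 and its limit at ζ = 0. -/

/-- The integrand, in `(x, t)`, of the resolvent kernel written as a double integral. -/
noncomputable def doubleKernel (n : ℕ) (ζ : ℂ) (S T x t : ℝ) : ℂ :=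
  (x : ℂ) ^ (n - 1) * ((Real.exp (-(2 * x * S * t)) : ℂ)
      * (t : ℂ) ^ ((n : ℂ) / 2 - ζ / (2 * x) - 1)
      * ((1 + t : ℝ) : ℂ) ^ ((n : ℂ) - ((n : ℂ) / 2 - ζ / (2 * x)) - 1))
    * (Real.exp (-(x * S)) : ℂ) * (Real.cos (x * T) : ℂ)

theorem doubleKernel_zero {n : ℕ} (hn : 1 ≤ n) (S T : ℝ) {x t : ℝ} (hx : 0 < x) (ht : 0 < t) :
    doubleKernel n 0 S T x t = ((x * quadrantKernel n S T (wedgeMap (x, t)) : ℝ) : ℂ) := by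
  rw [mul_quadrantKernel_wedgeMap hn S T hx ht,
    show -(x * S * (1 + 2 * t)) = -(2 * x * S * t) + -(x * S) by ring, Real.exp_add]
  simp only [doubleKernel, Complex.ofReal_mul, Complex.ofReal_pow, Complex.ofReal_cpow ht.le,
    Complex.ofReal_cpow (show 0 ≤ 1 + t by positivity)]
  push_cast
  rw [show (n : ℂ) / 2 - 0 / (2 * x) - 1 = (n : ℂ) / 2 - 1 by ring,
    show (n : ℂ) - (n / 2 - 0 / (2 * x)) - 1 = (n : ℂ) / 2 - 1 by ring]
  ring

/-- With r = -Re ζ/(2x) ≥ 0, the ζ-dependent factor has modulus (t/(1+t))^r ≤ 1. Bounding the cosine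
by 1 amounts to setting T = 0, so the majorant is itself a wedge pull-back of known integrability.
-/
theorem norm_doubleKernel_le {n : ℕ} (hn : 1 ≤ n) {ζ : ℂ} (hζ : ζ.re ≤ 0) (S T : ℝ) {x t : ℝ}
    (hx : 0 < x) (ht : 0 < t) :
    ‖doubleKernel n ζ S T x t‖ ≤ x * quadrantKernel n S 0 (wedgeMap (x, t)) := by
  have ht1 : 0 < 1 + t := by positivity
  have hre : (ζ / (2 * x)).re = ζ.re / (2 * x) := by
    rw [show (2 * x : ℂ) = ((2 * x : ℝ) : ℂ) by push_cast; rfl, Complex.div_ofReal_re]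
  have hr : ζ.re / (2 * x) ≤ 0 := div_nonpos_of_nonpos_of_nonneg hζ (by positivity)
  have e1 : ((n : ℂ) / 2 - ζ / (2 * x) - 1).re = (n : ℝ) / 2 - 1 + (-(ζ.re / (2 * x))) := by
    simp only [Complex.sub_re, hre, Complex.one_re]
    rw [show (n : ℂ) / 2 = ((n / 2 : ℝ) : ℂ) by push_cast; rfl, Complex.ofReal_re]; ring
  have e2 : ((n : ℂ) - ((n : ℂ) / 2 - ζ / (2 * x)) - 1).re
      = (n : ℝ) / 2 - 1 - (-(ζ.re / (2 * x))) := by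
    simp only [Complex.sub_re, hre, Complex.one_re]
    rw [show (n : ℂ) / 2 = ((n / 2 : ℝ) : ℂ) by push_cast; rfl, Complex.ofReal_re,
      Complex.natCast_re]; ring
  have hle : t ^ (-(ζ.re / (2 * x))) / (1 + t) ^ (-(ζ.re / (2 * x))) ≤ 1 :=
    div_le_one_of_le₀ (Real.rpow_le_rpow ht.le (by linarith) (by linarith)) (by positivity)
  rw [mul_quadrantKernel_wedgeMap hn S 0 hx ht,
    show -(x * S * (1 + 2 * t)) = -(2 * x * S * t) + -(x * S) by ring, Real.exp_add]
  simp only [doubleKernel, norm_mul, norm_pow, Complex.norm_real, Real.norm_eq_abs,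
    Real.abs_exp, Complex.norm_cpow_eq_rpow_re_of_pos ht,
    Complex.norm_cpow_eq_rpow_re_of_pos ht1, e1, e2, abs_of_pos hx]
  rw [Real.rpow_add ht, Real.rpow_sub ht1, mul_zero, Real.cos_zero]
  calc _ = (x ^ (n - 1) * (t ^ ((n : ℝ) / 2 - 1) * (1 + t) ^ ((n : ℝ) / 2 - 1))
        * (Real.exp (-(2 * x * S * t)) * Real.exp (-(x * S))))
        * ((t ^ (-(ζ.re / (2 * x))) / (1 + t) ^ (-(ζ.re / (2 * x)))) * |Real.cos (x * T)|) := by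
        ring
    _ ≤ (x ^ (n - 1) * (t ^ ((n : ℝ) / 2 - 1) * (1 + t) ^ ((n : ℝ) / 2 - 1))
        * (Real.exp (-(2 * x * S * t)) * Real.exp (-(x * S)))) * 1 := by
        gcongr
        exact mul_le_one₀ hle (abs_nonneg _) (Real.abs_cos_le_one _)

theorem aestronglyMeasurable_doubleKernel (n : ℕ) (ζ : ℂ) (S T : ℝ) :
    AEStronglyMeasurable (fun v : ℝ × ℝ => doubleKernel n ζ S T v.1 v.2)
      (volume.restrict (Ioi 0 ×ˢ Ioi 0)) := by
  refine Measurable.aestronglyMeasurable ?_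
  unfold doubleKernel
  fun_prop

theorem integrableOn_doubleKernel {n : ℕ} (hn : 1 ≤ n) {ζ : ℂ} (hζ : ζ.re ≤ 0) {S : ℝ}
    (hS : 0 < S) (T : ℝ) :
    IntegrableOn (fun v : ℝ × ℝ => doubleKernel n ζ S T v.1 v.2) (Ioi 0 ×ˢ Ioi 0) := by
  refine (integrableOn_wedgeMap (integrableOn_quadrantKernel hn hS 0)).mono'
    (aestronglyMeasurable_doubleKernel n ζ S T) ?_
  exact ae_restrict_of_forall_mem measurableSet_quadrant fun v hv =>
    norm_doubleKernel_le hn hζ S T hv.1 hv.2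

theorem integral_doubleKernel_zero {n : ℕ} (hn : 1 ≤ n) {S : ℝ} (hS : 0 < S) (T : ℝ) :
    ∫ v in Ioi (0 : ℝ) ×ˢ Ioi (0 : ℝ), doubleKernel n 0 S T v.1 v.2
      = ((Real.Gamma ((n : ℝ) / 2) ^ 2 * (S ^ 2 + T ^ 2) ^ (-(n : ℝ) / 2) / 2 : ℝ) : ℂ) := by
  rw [← integral_quadrantKernel hn hS T, ← integral_wedgeMap
    (integrableOn_quadrantKernel hn hS T) (quadrantKernel_swap n S T), ← integral_complex_ofReal]
  exact setIntegral_congr_fun measurableSet_quadrant fun v hv =>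
    doubleKernel_zero hn S T hv.1 hv.2

theorem tendsto_integral_doubleKernel {n : ℕ} (hn : 1 ≤ n) {S : ℝ} (hS : 0 < S) (T : ℝ) :
    Tendsto (fun ζ : ℂ => ∫ v in Ioi (0 : ℝ) ×ˢ Ioi (0 : ℝ), doubleKernel n ζ S T v.1 v.2)
      (𝓝[{ζ : ℂ | ζ.re < 0}] 0)
      (𝓝 (∫ v in Ioi (0 : ℝ) ×ˢ Ioi (0 : ℝ), doubleKernel n 0 S T v.1 v.2)) := by
  refine tendsto_integral_filter_of_dominated_convergence
    (fun v => v.1 * quadrantKernel n S 0 (wedgeMap v))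
    (Eventually.of_forall fun ζ => aestronglyMeasurable_doubleKernel n ζ S T) ?_
    (integrableOn_wedgeMap (integrableOn_quadrantKernel hn hS 0)) ?_
  · filter_upwards [self_mem_nhdsWithin] with ζ hζ
    exact ae_restrict_of_forall_mem measurableSet_quadrant fun v hv =>
      norm_doubleKernel_le hn (le_of_lt hζ) S T hv.1 hv.2
  · refine ae_restrict_of_forall_mem measurableSet_quadrant fun v hv => ?_
    have h1 : (v.2 : ℂ) ≠ 0 := by exact_mod_cast (show (0 : ℝ) < v.2 from hv.2).ne'
    have h2 : ((1 + v.2 : ℝ) : ℂ) ≠ 0 := by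
      exact_mod_cast (show (0 : ℝ) < 1 + v.2 by linarith [show (0 : ℝ) < v.2 from hv.2]).ne'
    refine Tendsto.mono_left ?_ nhdsWithin_le_nhds
    have : Continuous fun ζ : ℂ => doubleKernel n ζ S T v.1 v.2 := by
      unfold doubleKernel
      refine (((continuous_const.mul ((continuous_const.mul ?_).mul ?_)).mul
        continuous_const).mul continuous_const)
      · exact Continuous.const_cpow (by fun_prop) (Or.inl h1)
      · exact Continuous.const_cpow (by fun_prop) (Or.inl h2)
    exact this.tendsto 0

/-! ### From the double integral to the resolvent kernel. -/

theorem Gamma_mul_tricomiPsi {n : ℕ} (hn : 1 ≤ n) {ζ : ℂ} (hζ : ζ.re ≤ 0) (S T : ℝ) {x : ℝ}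
    (hx : 0 < x) :
    (x : ℂ) ^ (n - 1) * Complex.Gamma ((n : ℂ) / 2 - ζ / (2 * x))
        * tricomiPsi ((n : ℂ) / 2 - ζ / (2 * x)) n (2 * x * S)
        * (Real.exp (-(x * S)) : ℂ) * (Real.cos (x * T) : ℂ)
      = ∫ t in Ioi (0 : ℝ), doubleKernel n ζ S T x t := by
  have hre : (ζ / (2 * x)).re = ζ.re / (2 * x) := by
    rw [show (2 * x : ℂ) = ((2 * x : ℝ) : ℂ) by push_cast; rfl, Complex.div_ofReal_re]
  have hr : ζ.re / (2 * x) ≤ 0 := div_nonpos_of_nonpos_of_nonneg hζ (by positivity)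
  have hΓ : Complex.Gamma ((n : ℂ) / 2 - ζ / (2 * x)) ≠ 0 := by
    apply Complex.Gamma_ne_zero_of_re_pos
    rw [Complex.sub_re, hre, show (n : ℂ) / 2 = ((n / 2 : ℝ) : ℂ) by push_cast; rfl,
      Complex.ofReal_re]
    have : (0 : ℝ) < n := by exact_mod_cast hn
    linarith
  unfold doubleKernel tricomiPsi
  rw [integral_mul_const, integral_mul_const, integral_const_mul, ← mul_assoc,
    mul_assoc ((x : ℂ) ^ (n - 1)), mul_inv_cancel₀ hΓ, mul_one]

theorem integrableOn_integral_doubleKernel {n : ℕ} (hn : 1 ≤ n) {ζ : ℂ} (hζ : ζ.re ≤ 0) {S : ℝ}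
    (hS : 0 < S) (T : ℝ) :
    IntegrableOn (fun x => ∫ t in Ioi (0 : ℝ), doubleKernel n ζ S T x t) (Ioi 0) := by
  have h := integrableOn_doubleKernel hn hζ hS T
  rw [IntegrableOn, Measure.volume_eq_prod, ← Measure.prod_restrict] at h
  exact h.integral_prod_left

theorem integral_integral_doubleKernel {n : ℕ} (hn : 1 ≤ n) {ζ : ℂ} (hζ : ζ.re ≤ 0) {S : ℝ}
    (hS : 0 < S) (T : ℝ) :
    ∫ x in Ioi (0 : ℝ), ∫ t in Ioi (0 : ℝ), doubleKernel n ζ S T x t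
      = ∫ v in Ioi (0 : ℝ) ×ˢ Ioi (0 : ℝ), doubleKernel n ζ S T v.1 v.2 := by
  have h := integrableOn_doubleKernel hn hζ hS T
  rw [Measure.volume_eq_prod] at h ⊢
  rw [setIntegral_prod _ h]

theorem sqNorm_pos {n : ℕ} {z : Fin n → ℂ} (hz : z ≠ 0) : 0 < sqNorm z := by
  obtain ⟨j, hj⟩ := Function.ne_iff.1 hz
  exact Finset.sum_pos' (fun _ _ => by positivity)
    ⟨j, Finset.mem_univ j, by have := norm_pos_iff.2 hj; positivity⟩

theorem resolventIntegrand_eq {n : ℕ} (hn : 1 ≤ n) {ζ : ℂ} (hζ : ζ.re ≤ 0) (p q : Pt n) {x : ℝ}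
    (hx : 0 < x) :
    resolventIntegrand ζ p q x = ∫ t in Ioi (0 : ℝ),
      doubleKernel n ζ (sqNorm (p.1 - q.1)) (p.2 - q.2 + 2 * (herm p.1 q.1).im) x t := by
  rw [← Gamma_mul_tricomiPsi hn hζ _ _ hx, resolventIntegrand]
  congr 3
  ring

theorem integrableOn_resolventIntegrand {n : ℕ} (hn : 1 ≤ n) {ζ : ℂ} (hζ : ζ.re ≤ 0)
    {p q : Pt n} (hpq : p.1 ≠ q.1) : IntegrableOn (resolventIntegrand ζ p q) (Ioi (0 : ℝ)) :=
  (integrableOn_integral_doubleKernel hn hζ (sqNorm_pos (sub_ne_zero.2 hpq)) _).congr_fun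
    (fun _ hx => (resolventIntegrand_eq hn hζ p q hx).symm) measurableSet_Ioi

theorem resolventKernel_eq {n : ℕ} (hn : 1 ≤ n) {ζ : ℂ} (hζ : ζ.re ≤ 0)
    {p q : Pt n} (hpq : p.1 ≠ q.1) :
    resolventKernel ζ p q = -((2 ^ n * Real.pi ^ (-(n : ℝ) - 1 / 2) : ℝ) : ℂ)
      * ∫ v in Ioi (0 : ℝ) ×ˢ Ioi (0 : ℝ), doubleKernel n ζ (sqNorm (p.1 - q.1))
        (p.2 - q.2 + 2 * (herm p.1 q.1).im) v.1 v.2 := by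
  rw [← integral_integral_doubleKernel hn hζ (sqNorm_pos (sub_ne_zero.2 hpq)), resolventKernel]
  congr 1
  exact setIntegral_congr_fun measurableSet_Ioi fun x hx => resolventIntegrand_eq hn hζ p q hx

theorem tendsto_resolventKernel {n : ℕ} (hn : 1 ≤ n) {p q : Pt n} (hpq : p.1 ≠ q.1) :
    Tendsto (fun ζ : ℂ => resolventKernel ζ p q) (𝓝[{ζ : ℂ | ζ.re < 0}] 0)
      (𝓝 (resolventKernel 0 p q)) := by
  rw [resolventKernel_eq hn (by simp) hpq]
  refine ((tendsto_integral_doubleKernel hn (sqNorm_pos (sub_ne_zero.2 hpq)) _).const_mul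
    _).congr' ?_
  filter_upwards [self_mem_nhdsWithin] with ζ hζ
  rw [resolventKernel_eq hn (le_of_lt hζ) hpq]

theorem neg_resolventKernel_zero {n : ℕ} (hn : 1 ≤ n) {p q : Pt n} (hpq : p.1 ≠ q.1) :
    -resolventKernel 0 p q
      = ((2 ^ ((n : ℝ) - 1) * Real.Gamma ((n : ℝ) / 2) ^ 2 / Real.pi ^ ((n : ℝ) + 1 / 2)
          * (sqNorm (p.1 - q.1) ^ 2
              + (p.2 - q.2 + 2 * (herm p.1 q.1).im) ^ 2) ^ (-(n : ℝ) / 2) : ℝ) : ℂ) := by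
  rw [resolventKernel_eq hn (by simp) hpq,
    integral_doubleKernel_zero hn (sqNorm_pos (sub_ne_zero.2 hpq)), neg_mul, neg_neg,
    ← Complex.ofReal_mul, show -(n : ℝ) - 1 / 2 = -((n : ℝ) + 1 / 2) by ring,
    Real.rpow_neg Real.pi_pos.le, Real.rpow_sub two_pos, Real.rpow_natCast, Real.rpow_one]
  congr 1
  ring

/-- At ζ = 0 the Gamma factor no longer depends on x and is nonzero, so it can be pulled out of the
resolvent integral, both for integrability and for the value. -/
theorem integrableOn_follandIntegrand {n : ℕ} (hn : 1 ≤ n) {z : Fin n → ℂ} (hz : z ≠ 0) (τ : ℝ) :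
    IntegrableOn (fun x : ℝ => (x : ℂ) ^ (n - 1) * (Real.exp (-(x * sqNorm z)) : ℂ)
      * tricomiPsi ((n : ℂ) / 2) n (2 * x * sqNorm z) * (Real.cos (τ * x) : ℂ)) (Ioi (0 : ℝ)) ∧
    ((Real.Gamma ((n : ℝ) / 2) : ℝ) : ℂ) * ∫ x in Ioi (0 : ℝ), (x : ℂ) ^ (n - 1)
        * (Real.exp (-(x * sqNorm z)) : ℂ)
        * tricomiPsi ((n : ℂ) / 2) n (2 * x * sqNorm z) * (Real.cos (τ * x) : ℂ)
      = ((Real.Gamma ((n : ℝ) / 2) ^ 2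
          * (sqNorm z ^ 2 + τ ^ 2) ^ (-(n : ℝ) / 2) / 2 : ℝ) : ℂ) := by
  have hΓ : Complex.Gamma ((n : ℂ) / 2) = ((Real.Gamma ((n : ℝ) / 2) : ℝ) : ℂ) := by
    rw [← Complex.Gamma_ofReal]; push_cast; rfl
  have hn' : (0 : ℝ) < n := by exact_mod_cast hn
  have hΓ0 : ((Real.Gamma ((n : ℝ) / 2) : ℝ) : ℂ) ≠ 0 := by
    exact_mod_cast (Real.Gamma_pos_of_pos (by positivity)).ne'
  have h : ∀ x ∈ Ioi (0 : ℝ), ((Real.Gamma ((n : ℝ) / 2) : ℝ) : ℂ) * ((x : ℂ) ^ (n - 1)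
        * (Real.exp (-(x * sqNorm z)) : ℂ)
        * tricomiPsi ((n : ℂ) / 2) n (2 * x * sqNorm z) * (Real.cos (τ * x) : ℂ))
      = ∫ t in Ioi (0 : ℝ), doubleKernel n 0 (sqNorm z) τ x t := by
    intro x hx
    rw [← Gamma_mul_tricomiPsi hn (by simp) _ _ hx, zero_div, sub_zero, hΓ, mul_comm τ x]
    ring
  constructor
  · have h1 := (integrableOn_integral_doubleKernel hn (ζ := 0) (by simp) (sqNorm_pos hz) τ).congr_fun
      (fun x hx => (h x hx).symm) measurableSet_Ioi
    refine IntegrableOn.congr_fun (h1.const_mul ((Real.Gamma ((n : ℝ) / 2) : ℝ) : ℂ)⁻¹)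
      (fun x _ => ?_) measurableSet_Ioi
    exact inv_mul_cancel_left₀ hΓ0 _
  · rw [← integral_const_mul, ← integral_doubleKernel_zero hn (sqNorm_pos hz),
      ← integral_integral_doubleKernel hn (by simp) (sqNorm_pos hz)]
    exact setIntegral_congr_fun measurableSet_Ioi h

/-! ### The value of Folland's constant. -/

theorem sqNorm_nonneg {n : ℕ} (z : Fin n → ℂ) : 0 ≤ sqNorm z :=
  Finset.sum_nonneg fun _ _ => by positivity

theorem continuous_sqNorm {n : ℕ} : Continuous (sqNorm : (Fin n → ℂ) → ℝ) := by
  unfold sqNorm; fun_prop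

/-- Polar coordinates in `ℂⁿ` for functions of the Euclidean norm. -/
theorem integral_comp_sqrt_sqNorm {n : ℕ} (hn : 1 ≤ n) (f : ℝ → ℝ) :
    (Integrable (fun z : Fin n → ℂ => f √(sqNorm z)) ↔
      IntegrableOn (fun r : ℝ => r ^ (2 * n - 1) * f r) (Ioi 0)) ∧
    ∫ z : Fin n → ℂ, f √(sqNorm z)
      = 2 * n * (Real.pi ^ n / n.factorial) * ∫ r in Ioi (0 : ℝ), r ^ (2 * n - 1) * f r := by
  have : NeZero n := ⟨by omega⟩
  -- `Fin n → ℂ` carries the sup norm. Polar coordinates are therefore taken in the Euclidean space,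
  -- with Lebesgue measure transported there.
  set E := EuclideanSpace ℂ (Fin n)
  let e : (Fin n → ℂ) ≃L[ℝ] E := (PiLp.continuousLinearEquiv 2 ℝ (fun _ : Fin n => ℂ)).symm
  have hnorm : ∀ z, ‖e z‖ = √(sqNorm z) := fun z => EuclideanSpace.norm_eq (e z)
  let μ : Measure E := Measure.map e volume
  have : μ.IsAddHaarMeasure := e.isAddHaarMeasure_map volume
  have hfin : Module.finrank ℝ E = 2 * n := by
    rw [← LinearEquiv.finrank_eq e.toLinearEquiv, Module.finrank_pi_fintype]
    simp [Complex.finrank_real_complex, mul_comm]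
  have : Nontrivial E := Module.nontrivial_of_finrank_pos (R := ℝ) (by rw [hfin]; omega)
  have hemb : MeasurableEmbedding e := e.toHomeomorph.measurableEmbedding
  have hball : μ.real (Metric.ball 0 1) = Real.pi ^ n / n.factorial := by
    have h1 := Complex.volume_sum_rpow_lt_one (Fin n) (p := 2) (by norm_num)
    have h2 : e ⁻¹' Metric.ball 0 1 = {x : Fin n → ℂ | ∑ i, ‖x i‖ ^ (2 : ℝ) < 1} := by
      ext z
      simp only [mem_preimage, mem_ball_zero_iff, hnorm, Set.mem_ofPred_eq]
      rw [Real.sqrt_lt' one_pos, one_pow]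
      simp [sqNorm]
    rw [Measure.real, hemb.map_apply, h2, h1, ENNReal.toReal_ofReal]
    · simp only [Fintype.card_fin]
      rw [show (2 : ℝ) / 2 + 1 = 2 by norm_num, show 2 * (n : ℝ) / 2 + 1 = n + 1 by ring,
        Real.Gamma_nat_eq_factorial, Real.Gamma_two, mul_one]
    · have : 0 < Real.Gamma (2 * (Fintype.card (Fin n) : ℝ) / 2 + 1) :=
        Real.Gamma_pos_of_pos (by positivity)
      have : 0 < Real.Gamma (2 / 2 + 1) := Real.Gamma_pos_of_pos (by positivity)
      have := Real.pi_pos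
      positivity
  have h3 := integrable_fun_norm_addHaar μ (f := f)
  have h4 := integral_fun_norm_addHaar μ f
  rw [hemb.integrable_map_iff] at h3
  rw [hemb.integral_map] at h4
  simp only [Function.comp_def, hnorm, hfin, hball, smul_eq_mul, nsmul_eq_mul] at h3 h4
  refine ⟨h3, h4.trans ?_⟩
  push_cast; ring

/-- Write Γ(b)(1+t²)^(-b) as ∫ x^(b-1) e^(-x(1+t²)) dx and exchange the integrals: the t-integral is
Gaussian and leaves Γ(b-1/2). Positivity of the integrand makes Fubini available. -/
theorem integral_one_add_sq_rpow {b : ℝ} (hb : 1 / 2 < b) :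
    Integrable (fun t : ℝ => (1 + t ^ 2) ^ (-b)) ∧
    ∫ t : ℝ, (1 + t ^ 2) ^ (-b) = √Real.pi * Real.Gamma (b - 1 / 2) / Real.Gamma b := by
  have hb0 : 0 < b := by linarith
  have hΓ := Real.Gamma_pos_of_pos hb0
  set F : ℝ × ℝ → ℝ := fun v => v.1 ^ (b - 1) * Real.exp (-(v.1 * (1 + v.2 ^ 2))) with hF
  have hFx : ∀ x t, F (x, t) = x ^ (b - 1) * Real.exp (-x) * Real.exp (-x * t ^ 2) := fun x t => by
    simp only [hF]; rw [mul_assoc, ← Real.exp_add]; ring_nf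
  have hmeas : AEStronglyMeasurable F ((volume.restrict (Ioi (0 : ℝ))).prod volume) := by
    refine Measurable.aestronglyMeasurable ?_
    rw [hF]; fun_prop
  have hint : ∀ x ∈ Ioi (0 : ℝ), ∫ t, F (x, t) = √Real.pi * (Real.exp (-x) * x ^ (b - 1 / 2 - 1)) := by
    intro x hx
    have hx : 0 < x := hx
    simp only [hFx]
    rw [integral_const_mul, integral_gaussian, Real.sqrt_div' _ hx.le,
      show b - 1 / 2 - 1 = (b - 1) - 1 / 2 by ring, Real.rpow_sub hx (b - 1), ← Real.sqrt_eq_rpow]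
    ring
  have hnn : ∀ x ∈ Ioi (0 : ℝ), ∀ t, ‖F (x, t)‖ = F (x, t) := fun x hx t => by
    have hx : 0 < x := hx
    exact Real.norm_of_nonneg (by positivity)
  have hI : Integrable F ((volume.restrict (Ioi (0 : ℝ))).prod volume) := by
    rw [integrable_prod_iff hmeas]
    constructor
    · refine ae_restrict_of_forall_mem measurableSet_Ioi fun x hx => ?_
      simp only [hFx]
      exact (integrable_exp_neg_mul_sq hx).const_mul _
    · refine IntegrableOn.congr_fun (f := fun x => √Real.pi * (Real.exp (-x) * x ^ (b - 1 / 2 - 1)))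
        (Integrable.const_mul (Real.GammaIntegral_convergent (by linarith)) _)
        (fun x hx => ?_) measurableSet_Ioi
      simp only [hnn x hx, hint x hx]
  have hinner : ∀ t : ℝ, ∫ x in Ioi (0 : ℝ), F (x, t) = Real.Gamma b * (1 + t ^ 2) ^ (-b) := by
    intro t
    have h := Real.integral_rpow_mul_exp_neg_mul_Ioi hb0 (show 0 < 1 + t ^ 2 by positivity)
    rw [one_div, Real.inv_rpow (by positivity), ← Real.rpow_neg (by positivity)] at h
    rw [mul_comm, ← h]
    refine integral_congr_ae (ae_of_all _ fun x => ?_)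
    simp only [hF, mul_comm]
  have h1 := hI.integral_prod_right
  simp only [hinner] at h1
  have h2 := integral_integral_swap (f := fun x t => F (x, t)) hI
  simp only [hinner] at h2
  rw [setIntegral_congr_fun measurableSet_Ioi hint, integral_const_mul, integral_const_mul,
    ← Real.Gamma_eq_integral (by linarith)] at h2
  constructor
  · refine (h1.const_mul (Real.Gamma b)⁻¹).congr (ae_of_all _ fun t => ?_)
    exact inv_mul_cancel_left₀ hΓ.ne' _
  · rw [h2]
    field_simp

theorem integral_add_sq_rpow {b : ℝ} (hb : 1 / 2 < b) {A : ℝ} (hA : 0 < A) :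
    Integrable (fun t : ℝ => (A + t ^ 2) ^ (-b)) ∧
    ∫ t : ℝ, (A + t ^ 2) ^ (-b)
      = A ^ (1 / 2 - b) * (√Real.pi * Real.Gamma (b - 1 / 2) / Real.Gamma b) := by
  obtain ⟨h1, h2⟩ := integral_one_add_sq_rpow hb
  have hs : 0 < √A := Real.sqrt_pos.2 hA
  have e : ∀ t : ℝ, (A + t ^ 2) ^ (-b) = A ^ (-b) * (1 + (t / √A) ^ 2) ^ (-b) := fun t => by
    rw [← Real.mul_rpow hA.le (by positivity), div_pow, Real.sq_sqrt hA.le]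
    congr 1
    field_simp
  simp only [e]
  refine ⟨(h1.comp_div hs.ne').const_mul _, ?_⟩
  rw [integral_const_mul, Measure.integral_comp_div (fun t : ℝ => (1 + t ^ 2) ^ (-b)), h2,
    abs_of_pos hs, smul_eq_mul, ← mul_assoc, Real.sqrt_eq_rpow, ← Real.rpow_add hA]
  ring_nf

theorem integral_pow_mul_one_add_pow_four_rpow (n : ℕ) :
    IntegrableOn (fun r : ℝ => r ^ (2 * n + 1) * (1 + r ^ 4) ^ (-((n : ℝ) + 3) / 2)) (Ioi 0) ∧
    ∫ r in Ioi (0 : ℝ), r ^ (2 * n + 1) * (1 + r ^ 4) ^ (-((n : ℝ) + 3) / 2)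
      = 1 / (2 * ((n : ℝ) + 1)) := by
  -- An explicit antiderivative; it vanishes at 0 and tends to 1/(2(n+1)) at infinity.
  set g : ℝ → ℝ := fun r => r ^ (2 * n + 2) * (1 + r ^ 4) ^ (-((n : ℝ) + 1) / 2)
    / (2 * ((n : ℝ) + 1)) with hg
  have hn : (0 : ℝ) < n + 1 := by positivity
  have hderiv : ∀ r : ℝ, HasDerivAt g (r ^ (2 * n + 1) * (1 + r ^ 4) ^ (-((n : ℝ) + 3) / 2)) r := by
    intro r
    have hp : 0 < 1 + r ^ 4 := by positivity
    have h1 : HasDerivAt (fun r : ℝ => 1 + r ^ 4) (4 * r ^ 3) r := by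
      simpa using (hasDerivAt_pow 4 r).const_add 1
    have h2 := h1.rpow_const (p := -((n : ℝ) + 1) / 2) (Or.inl hp.ne')
    have h3 := ((hasDerivAt_pow (2 * n + 2) r).mul h2).div_const (2 * ((n : ℝ) + 1))
    refine h3.congr_deriv ?_
    rw [show -((n : ℝ) + 1) / 2 - 1 = -((n : ℝ) + 3) / 2 by ring,
      show -((n : ℝ) + 1) / 2 = -((n : ℝ) + 3) / 2 + 1 by ring, Real.rpow_add_one hp.ne']
    simp only [Nat.cast_add, Nat.cast_mul, Nat.cast_ofNat,
      show 2 * n + 2 - 1 = 2 * n + 1 by omega]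
    field_simp
    ring
  have hlim : Tendsto g atTop (𝓝 (1 / (2 * ((n : ℝ) + 1)))) := by
    have h0 : Tendsto (fun r : ℝ => (1 + (r ^ 4)⁻¹) ^ (-((n : ℝ) + 1) / 2)) atTop (𝓝 1) := by
      have : Tendsto (fun r : ℝ => 1 + (r ^ 4)⁻¹) atTop (𝓝 (1 + 0)) :=
        (tendsto_inv_atTop_zero.comp (tendsto_pow_atTop (by norm_num))).const_add 1
      simpa using this.rpow_const (p := -((n : ℝ) + 1) / 2) (Or.inl (by norm_num))
    refine (h0.div_const _).congr' ?_
    filter_upwards [eventually_gt_atTop 0] with r hr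
    simp only [hg]
    congr 1
    rw [show (1 + r ^ 4 : ℝ) = r ^ 4 * (1 + (r ^ 4)⁻¹) by field_simp; ring,
      Real.mul_rpow (by positivity) (by positivity), ← mul_assoc]
    have : r ^ (2 * n + 2) * (r ^ 4) ^ (-((n : ℝ) + 1) / 2) = 1 := by
      rw [← Real.rpow_natCast, ← Real.rpow_natCast, ← Real.rpow_mul hr.le, ← Real.rpow_add hr,
        show ((2 * n + 2 : ℕ) : ℝ) + ((4 : ℕ) : ℝ) * (-((n : ℝ) + 1) / 2) = 0 by push_cast; ring,
        Real.rpow_zero]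
    rw [this, one_mul]
  have hnn : ∀ r ∈ Ioi (0 : ℝ), 0 ≤ r ^ (2 * n + 1) * (1 + r ^ 4) ^ (-((n : ℝ) + 3) / 2) :=
    fun r hr => by have hr : 0 < r := hr; positivity
  refine ⟨integrableOn_Ioi_deriv_of_nonneg' (fun r _ => hderiv r) hnn hlim, ?_⟩
  rw [integral_Ioi_of_hasDerivAt_of_nonneg' (fun r _ => hderiv r) hnn hlim]
  simp [hg]

theorem integral_follandDensity {n : ℕ} (hn : 1 ≤ n) :
    ∫ p : Pt n, sqNorm p.1 * (sqNorm p.1 ^ 2 + p.2 ^ 2 + 1) ^ (-((n : ℝ) + 4) / 2)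
      = √Real.pi * Real.Gamma (((n : ℝ) + 3) / 2) / Real.Gamma (((n : ℝ) + 4) / 2)
        * (2 * n * (Real.pi ^ n / n.factorial) * (1 / (2 * ((n : ℝ) + 1)))) := by
  have hn' : (0 : ℝ) < n := by exact_mod_cast hn
  set C := √Real.pi * Real.Gamma (((n : ℝ) + 3) / 2) / Real.Gamma (((n : ℝ) + 4) / 2)
  set F : Pt n → ℝ := fun p => sqNorm p.1 * (sqNorm p.1 ^ 2 + p.2 ^ 2 + 1) ^ (-((n : ℝ) + 4) / 2)
    with hF
  have hFt : ∀ z t, F (z, t) = sqNorm z * ((1 + sqNorm z ^ 2) + t ^ 2) ^ (-(((n : ℝ) + 4) / 2)) :=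
    fun z t => by simp only [hF]; congr 2 <;> ring
  have hb : (1 : ℝ) / 2 < ((n : ℝ) + 4) / 2 := by linarith
  have hin : ∀ z, Integrable (fun t => F (z, t)) := fun z => by
    simp only [hFt]
    exact (integral_add_sq_rpow hb (by positivity)).1.const_mul _
  have hint : ∀ z, ∫ t, F (z, t)
      = C * (√(sqNorm z) ^ 2 * (1 + √(sqNorm z) ^ 4) ^ (-((n : ℝ) + 3) / 2)) := fun z => by
    simp only [hFt]
    rw [integral_const_mul, (integral_add_sq_rpow hb (by positivity)).2, show 4 = 2 * 2 by norm_num,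
      pow_mul, Real.sq_sqrt (sqNorm_nonneg z),
      show (1 : ℝ) / 2 - ((n : ℝ) + 4) / 2 = -((n : ℝ) + 3) / 2 by ring,
      show ((n : ℝ) + 4) / 2 - 1 / 2 = ((n : ℝ) + 3) / 2 by ring]
    simp only [C]
    ring
  obtain ⟨hr1, hr2⟩ := integral_comp_sqrt_sqNorm hn
    (fun r => r ^ 2 * (1 + r ^ 4) ^ (-((n : ℝ) + 3) / 2))
  obtain ⟨hq1, hq2⟩ := integral_pow_mul_one_add_pow_four_rpow n
  have hpow : ∀ r : ℝ, r ^ (2 * n - 1) * (r ^ 2 * (1 + r ^ 4) ^ (-((n : ℝ) + 3) / 2))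
      = r ^ (2 * n + 1) * (1 + r ^ 4) ^ (-((n : ℝ) + 3) / 2) := fun r => by
    rw [← mul_assoc, ← pow_add]
    congr 2
    omega
  simp only [hpow] at hr1 hr2
  have hcont : Continuous F := by
    have := continuous_sqNorm (n := n)
    refine (this.comp continuous_fst).mul (Continuous.rpow_const (by fun_prop) fun p => Or.inl ?_)
    positivity
  have hFI : Integrable F ((volume : Measure (Fin n → ℂ)).prod volume) := by
    rw [integrable_prod_iff hcont.aestronglyMeasurable]
    refine ⟨ae_of_all _ hin, ?_⟩
    have : ∀ z t, ‖F (z, t)‖ = F (z, t) := fun z t => by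
      rw [hFt]
      have := sqNorm_nonneg z
      exact Real.norm_of_nonneg (by positivity)
    simp only [this, hint]
    exact (hr1.2 hq1).const_mul C
  rw [Measure.volume_eq_prod, integral_prod _ hFI]
  simp only [hint]
  rw [integral_const_mul, hr2, hq2]

theorem follandConst_eq {n : ℕ} (hn : 1 ≤ n) :
    follandConst n
      = 2 ^ ((n : ℝ) - 2) * Real.Gamma ((n : ℝ) / 2) ^ 2 / Real.pi ^ ((n : ℝ) + 1) := by
  have hn' : (0 : ℝ) < n := by exact_mod_cast hn
  rw [follandConst, integral_follandDensity hn]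
  have h3 : Real.Gamma (((n : ℝ) + 3) / 2) = ((n : ℝ) + 1) / 2 * Real.Gamma (((n : ℝ) + 1) / 2) := by
    rw [← Real.Gamma_add_one (by positivity)]; congr 1; ring
  have h4 : Real.Gamma (((n : ℝ) + 4) / 2)
      = ((n : ℝ) + 2) / 2 * ((n : ℝ) / 2 * Real.Gamma ((n : ℝ) / 2)) := by
    rw [← Real.Gamma_add_one (by positivity),
      show ((n : ℝ) + 2) / 2 = (n : ℝ) / 2 + 1 by ring, ← Real.Gamma_add_one (by positivity)]
    congr 1; ring
  -- Duplication at n/2 trades Γ((n+1)/2) for Γ(n)/Γ(n/2); this is where the square of Γ(n/2) comes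
  -- from.
  have hd := Real.Gamma_mul_Gamma_add_half ((n : ℝ) / 2)
  rw [show (n : ℝ) / 2 + 1 / 2 = ((n : ℝ) + 1) / 2 by ring,
    show 2 * ((n : ℝ) / 2) = n by ring] at hd
  have hf : Real.Gamma n * n = n.factorial := by
    rw [mul_comm, ← Real.Gamma_add_one hn'.ne', Real.Gamma_nat_eq_factorial]
  have hG := Real.Gamma_pos_of_pos (show 0 < (n : ℝ) / 2 by positivity)
  have hGn := Real.Gamma_pos_of_pos hn'
  have hG1 : Real.Gamma (((n : ℝ) + 1) / 2)
      = Real.Gamma n * 2 ^ (1 - (n : ℝ)) * √Real.pi / Real.Gamma ((n : ℝ) / 2) := by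
    rw [← hd]; field_simp
  have hpi := Real.pi_pos
  have hs : √Real.pi * √Real.pi = Real.pi := Real.mul_self_sqrt hpi.le
  rw [h3, h4, hG1, ← hf, Real.rpow_add_one hpi.ne', Real.rpow_natCast,
    Real.rpow_sub two_pos, Real.rpow_sub two_pos, Real.rpow_natCast]
  norm_num
  field_simp
  rw [pow_two √Real.pi, hs]
  norm_num

/-! ### First-order operators: Leibniz rule and integration by parts. -/

/-- A complex combination of two directional derivatives. -/
noncomputable def dirDeriv {n : ℕ} (c d : ℂ) (v w : Pt n) (f : Pt n → ℂ) (p : Pt n) : ℂ :=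
  c * fderiv ℝ f p v + d * fderiv ℝ f p w

section DirDeriv

variable {n : ℕ} (c d : ℂ) (v w : Pt n)

theorem partialZ_eq (j : Fin n) : partialZ j =
    dirDeriv (1 / 2) (-(Complex.I / 2)) (Pi.single j 1, 0) (Pi.single j Complex.I, 0) := by
  ext f p
  simp only [partialZ, dirDeriv, partialX, partialY]
  ring

theorem partialZbar_eq (j : Fin n) : partialZbar j =
    dirDeriv (1 / 2) (Complex.I / 2) (Pi.single j 1, 0) (Pi.single j Complex.I, 0) := by
  ext f p
  simp only [partialZbar, dirDeriv, partialX, partialY]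
  ring

theorem partialT_eq : partialT (n := n) = dirDeriv 1 0 (0, 1) 0 := by
  ext f p
  simp [partialT, dirDeriv]

theorem dirDeriv_mul {f g : Pt n → ℂ} {p : Pt n} (hf : DifferentiableAt ℝ f p)
    (hg : DifferentiableAt ℝ g p) :
    dirDeriv c d v w (fun q => f q * g q) p
      = dirDeriv c d v w f p * g p + f p * dirDeriv c d v w g p := by
  simp only [dirDeriv, fderiv_fun_mul hf hg, add_apply, smul_apply, smul_eq_mul]
  ring

theorem dirDeriv_add {f g : Pt n → ℂ} {p : Pt n} (hf : DifferentiableAt ℝ f p)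
    (hg : DifferentiableAt ℝ g p) :
    dirDeriv c d v w (fun q => f q + g q) p
      = dirDeriv c d v w f p + dirDeriv c d v w g p := by
  simp only [dirDeriv, fderiv_fun_add hf hg, add_apply]
  ring

theorem dirDeriv_const (a : ℂ) (p : Pt n) : dirDeriv c d v w (fun _ => a) p = 0 := by
  simp [dirDeriv]

theorem dirDeriv_sum {ι : Type*} (s : Finset ι) {f : ι → Pt n → ℂ} {p : Pt n}
    (hf : ∀ i ∈ s, DifferentiableAt ℝ (f i) p) :
    dirDeriv c d v w (fun q => ∑ i ∈ s, f i q) p = ∑ i ∈ s, dirDeriv c d v w (f i) p := by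
  simp only [dirDeriv, fderiv_fun_sum hf, sum_apply, Finset.mul_sum,
    Finset.sum_add_distrib]

theorem dirDeriv_coord (k : Fin n) (p : Pt n) :
    dirDeriv c d v w (fun q => q.1 k) p = c * v.1 k + d * w.1 k := by
  have h : HasFDerivAt (fun q : Pt n => q.1 k)
      ((ContinuousLinearMap.proj (R := ℝ) k).comp (ContinuousLinearMap.fst ℝ (Fin n → ℂ) ℝ)) p :=
    ((ContinuousLinearMap.proj (R := ℝ) k).comp (ContinuousLinearMap.fst ℝ (Fin n → ℂ) ℝ)).hasFDerivAt
  rw [dirDeriv, h.fderiv]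
  simp

theorem dirDeriv_conj_coord (k : Fin n) (p : Pt n) :
    dirDeriv c d v w (fun q => (starRingEnd ℂ) (q.1 k)) p
      = c * (starRingEnd ℂ) (v.1 k) + d * (starRingEnd ℂ) (w.1 k) := by
  have h : HasFDerivAt (fun q : Pt n => (starRingEnd ℂ) (q.1 k))
      ((Complex.conjCLE : ℂ →L[ℝ] ℂ).comp ((ContinuousLinearMap.proj (R := ℝ) k).comp
        (ContinuousLinearMap.fst ℝ (Fin n → ℂ) ℝ))) p :=
    ((Complex.conjCLE : ℂ →L[ℝ] ℂ).comp ((ContinuousLinearMap.proj (R := ℝ) k).comp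
      (ContinuousLinearMap.fst ℝ (Fin n → ℂ) ℝ))).hasFDerivAt
  rw [dirDeriv, h.fderiv]
  simp

theorem dirDeriv_time (p : Pt n) :
    dirDeriv c d v w (fun q => (q.2 : ℂ)) p = c * v.2 + d * w.2 := by
  have h : HasFDerivAt (fun q : Pt n => (q.2 : ℂ))
      (Complex.ofRealCLM.comp (ContinuousLinearMap.snd ℝ (Fin n → ℂ) ℝ)) p :=
    (Complex.ofRealCLM.comp (ContinuousLinearMap.snd ℝ (Fin n → ℂ) ℝ)).hasFDerivAt
  rw [dirDeriv, h.fderiv]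
  simp

theorem dirDeriv_ofReal_rpow {Q : Pt n → ℝ} {p : Pt n} (hQ : DifferentiableAt ℝ Q p)
    (hp : Q p ≠ 0) (b : ℝ) :
    dirDeriv c d v w (fun q => ((Q q ^ b : ℝ) : ℂ)) p
      = b * ((Q p ^ (b - 1) : ℝ) : ℂ) * dirDeriv c d v w (fun q => (Q q : ℂ)) p := by
  have h1 : HasFDerivAt (fun q => (Q q : ℂ)) (Complex.ofRealCLM.comp (fderiv ℝ Q p)) p :=
    Complex.ofRealCLM.hasFDerivAt.comp p hQ.hasFDerivAt
  have h2 : HasFDerivAt (fun q => ((Q q ^ b : ℝ) : ℂ))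
      (Complex.ofRealCLM.comp ((b * Q p ^ (b - 1)) • fderiv ℝ Q p)) p :=
    Complex.ofRealCLM.hasFDerivAt.comp p (hQ.hasFDerivAt.rpow_const (Or.inl hp))
  rw [dirDeriv, dirDeriv, h1.fderiv, h2.fderiv]
  simp
  ring

theorem contDiff_dirDeriv {f : Pt n → ℂ} (hf : ContDiff ℝ ∞ f) :
    ContDiff ℝ ∞ (dirDeriv c d v w f) := by
  have h := hf.fderiv_right (m := ∞) (by simp)
  exact (contDiff_const.mul (h.clm_apply contDiff_const)).add
    (contDiff_const.mul (h.clm_apply contDiff_const))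

theorem hasCompactSupport_dirDeriv {f : Pt n → ℂ} (hf : HasCompactSupport f) :
    HasCompactSupport (dirDeriv c d v w f) :=
  (hf.fderiv_apply ℝ v).mul_left.add (hf.fderiv_apply ℝ w).mul_left

instance : (volume : Measure (Pt n)).IsAddHaarMeasure :=
  Measure.prod.instIsAddHaarMeasure _ _

theorem integrable_mul_of_hasCompactSupport {f g : Pt n → ℂ} (hf : Continuous f)
    (hfc : HasCompactSupport f) (hg : Continuous g) : Integrable fun p => f p * g p :=
  (hf.mul hg).integrable_of_hasCompactSupport hfc.mul_right

theorem integral_dirDeriv_mul {f g : Pt n → ℂ} (hf : ContDiff ℝ ∞ f) (hfc : HasCompactSupport f)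
    (hg : ContDiff ℝ ∞ g) :
    ∫ p, dirDeriv c d v w f p * g p = -∫ p, f p * dirDeriv c d v w g p := by
  have hcf : ∀ u, Continuous fun p => fderiv ℝ f p u := fun u =>
    (hf.continuous_fderiv (by simp)).clm_apply continuous_const
  have hcg : ∀ u, Continuous fun p => fderiv ℝ g p u := fun u =>
    (hg.continuous_fderiv (by simp)).clm_apply continuous_const
  have h1 : ∀ u, Integrable fun p => fderiv ℝ f p u * g p := fun u =>
    integrable_mul_of_hasCompactSupport (hcf u) (hfc.fderiv_apply ℝ u) hg.continuous
  have h2 : ∀ u, Integrable fun p => f p * fderiv ℝ g p u := fun u =>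
    integrable_mul_of_hasCompactSupport hf.continuous hfc (hcg u)
  have h3 : ∀ u, ∫ p, f p * fderiv ℝ g p u = -∫ p, fderiv ℝ f p u * g p := fun u =>
    integral_mul_fderiv_eq_neg_fderiv_mul_of_integrable (h1 u) (h2 u)
      (integrable_mul_of_hasCompactSupport hf.continuous hfc hg.continuous)
      (fun x _ => hf.differentiable (by simp) x) (fun x _ => hg.differentiable (by simp) x)
  have e1 : ∀ p, dirDeriv c d v w f p * g p
      = c * (fderiv ℝ f p v * g p) + d * (fderiv ℝ f p w * g p) := fun p => by
    rw [dirDeriv]; ring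
  have e2 : ∀ p, f p * dirDeriv c d v w g p
      = c * (f p * fderiv ℝ g p v) + d * (f p * fderiv ℝ g p w) := fun p => by
    rw [dirDeriv]; ring
  simp only [e1, e2]
  rw [integral_add ((h1 v).const_mul _) ((h1 w).const_mul _),
    integral_add ((h2 v).const_mul _) ((h2 w).const_mul _)]
  simp only [integral_const_mul, h3]
  ring

end DirDeriv

/-! ### Derivatives of powers of the regularized gauge. -/

variable {n : ℕ}

theorem contDiff_coord (j : Fin n) : ContDiff ℝ ∞ fun q : Pt n => q.1 j := by fun_prop

theorem contDiff_conj_coord (j : Fin n) :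
    ContDiff ℝ ∞ fun q : Pt n => (starRingEnd ℂ) (q.1 j) :=
  Complex.conjCLE.contDiff.comp (contDiff_coord j)

theorem contDiff_sqNorm : ContDiff ℝ ∞ fun q : Pt n => sqNorm q.1 := by
  unfold sqNorm
  exact ContDiff.sum fun j _ => (contDiff_norm_sq ℝ).comp (contDiff_coord j)

theorem ofReal_sqNorm (z : Fin n → ℂ) : (sqNorm z : ℂ) = ∑ k, z k * (starRingEnd ℂ) (z k) := by
  simp [sqNorm, Complex.mul_conj']

/-- The regularized gauge `|z|⁴ + t² + e²`. -/
noncomputable def regGauge (e : ℝ) (p : Pt n) : ℝ := sqNorm p.1 ^ 2 + p.2 ^ 2 + e ^ 2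

theorem regGauge_pos {e : ℝ} (he : e ≠ 0) (p : Pt n) : 0 < regGauge e p := by
  unfold regGauge; positivity

theorem contDiff_regGauge (e : ℝ) : ContDiff ℝ ∞ (regGauge (n := n) e) :=
  ((contDiff_sqNorm.pow 2).add (contDiff_snd.pow 2)).add contDiff_const

/-- The real powers of the regularized gauge, as complex functions. -/
noncomputable def regPow (e b : ℝ) (p : Pt n) : ℂ := ((regGauge e p ^ b : ℝ) : ℂ)

theorem contDiff_regPow {e : ℝ} (he : e ≠ 0) (b : ℝ) : ContDiff ℝ ∞ (regPow (n := n) e b) :=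
  Complex.ofRealCLM.contDiff.comp
    ((contDiff_regGauge e).rpow_const_of_ne fun p => (regGauge_pos he p).ne')

/-- Brings the two powers produced by second derivatives to a common exponent, so that the remaining
identity is polynomial. -/
theorem regPow_sub_one {e : ℝ} (he : e ≠ 0) (b : ℝ) (p : Pt n) :
    regPow e b p = ((sqNorm p.1 : ℂ) ^ 2 + (p.2 : ℂ) ^ 2 + (e : ℂ) ^ 2) * regPow e (b - 1) p := by
  have h := Real.rpow_add_one (regGauge_pos he p).ne' (b - 1)
  rw [sub_add_cancel] at h
  simp only [regPow, h, Complex.ofReal_mul]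
  rw [mul_comm]
  congr 1
  simp [regGauge]

theorem dirDeriv_sqNorm (c d : ℂ) (v w : Pt n) (p : Pt n) :
    dirDeriv c d v w (fun q => (sqNorm q.1 : ℂ)) p
      = ∑ k, ((c * v.1 k + d * w.1 k) * (starRingEnd ℂ) (p.1 k)
        + p.1 k * (c * (starRingEnd ℂ) (v.1 k) + d * (starRingEnd ℂ) (w.1 k))) := by
  have hz : ∀ k, DifferentiableAt ℝ (fun q : Pt n => q.1 k) p := fun k =>
    (contDiff_coord k).differentiable (by simp) p
  have hzb : ∀ k, DifferentiableAt ℝ (fun q : Pt n => (starRingEnd ℂ) (q.1 k)) p := fun k =>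
    (contDiff_conj_coord k).differentiable (by simp) p
  simp only [ofReal_sqNorm]
  rw [dirDeriv_sum _ _ _ _ _ fun k _ => (hz k).fun_mul (hzb k)]
  refine Finset.sum_congr rfl fun k _ => ?_
  rw [dirDeriv_mul _ _ _ _ (hz k) (hzb k), dirDeriv_coord, dirDeriv_conj_coord]

theorem dirDeriv_regPow (c d : ℂ) (v w : Pt n) {e : ℝ} (he : e ≠ 0) (b : ℝ) (p : Pt n) :
    dirDeriv c d v w (regPow e b) p = 2 * b * regPow e (b - 1) p
      * (sqNorm p.1 * dirDeriv c d v w (fun q => (sqNorm q.1 : ℂ)) p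
        + p.2 * dirDeriv c d v w (fun q => (q.2 : ℂ)) p) := by
  have hs : DifferentiableAt ℝ (fun q : Pt n => (sqNorm q.1 : ℂ)) p :=
    (Complex.ofRealCLM.contDiff.comp contDiff_sqNorm).differentiable (n := ∞) (by simp) p
  have ht : DifferentiableAt ℝ (fun q : Pt n => (q.2 : ℂ)) p :=
    (Complex.ofRealCLM.contDiff.comp contDiff_snd).differentiable (n := ∞) (by simp) p
  have h := dirDeriv_ofReal_rpow c d v w
    ((contDiff_regGauge e).differentiable (by simp) p) (regGauge_pos he p).ne' b
  have e1 : (fun q : Pt n => (regGauge e q : ℂ))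
      = fun q => ((sqNorm q.1 : ℂ) * (sqNorm q.1 : ℂ) + (q.2 : ℂ) * (q.2 : ℂ)) + (e : ℂ) ^ 2 := by
    ext q; simp only [regGauge]; push_cast; ring
  rw [e1, dirDeriv_add _ _ _ _ ((hs.fun_mul hs).fun_add (ht.fun_mul ht)) (by fun_prop),
    dirDeriv_add _ _ _ _ (hs.fun_mul hs) (ht.fun_mul ht), dirDeriv_const,
    dirDeriv_mul _ _ _ _ hs hs, dirDeriv_mul _ _ _ _ ht ht] at h
  refine h.trans ?_
  simp only [regPow]
  ring

theorem partialZ_coord (j : Fin n) (p : Pt n) : partialZ j (fun q => q.1 j) p = 1 := by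
  rw [partialZ_eq, dirDeriv_coord]
  simp only [Pi.single_eq_same]
  linear_combination (-1 / 2 : ℂ) * Complex.I_mul_I

theorem partialZbar_conj_coord (j : Fin n) (p : Pt n) :
    partialZbar j (fun q => (starRingEnd ℂ) (q.1 j)) p = 1 := by
  rw [partialZbar_eq, dirDeriv_conj_coord]
  simp only [Pi.single_eq_same, map_one, Complex.conj_I]
  linear_combination (-1 / 2 : ℂ) * Complex.I_mul_I

theorem partialZ_sqNorm (j : Fin n) (p : Pt n) :
    partialZ j (fun q => (sqNorm q.1 : ℂ)) p = (starRingEnd ℂ) (p.1 j) := by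
  rw [partialZ_eq, dirDeriv_sqNorm, Finset.sum_eq_single j]
  · simp only [Pi.single_eq_same, map_one, Complex.conj_I]
    linear_combination (-1 / 2 * (starRingEnd ℂ) (p.1 j) + 1 / 2 * p.1 j) * Complex.I_mul_I
  · intro k _ hk; simp [Pi.single_eq_of_ne hk]
  · simp

theorem partialZbar_sqNorm (j : Fin n) (p : Pt n) :
    partialZbar j (fun q => (sqNorm q.1 : ℂ)) p = p.1 j := by
  rw [partialZbar_eq, dirDeriv_sqNorm, Finset.sum_eq_single j]
  · simp only [Pi.single_eq_same, map_one, Complex.conj_I]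
    linear_combination (1 / 2 * (starRingEnd ℂ) (p.1 j) - 1 / 2 * p.1 j) * Complex.I_mul_I
  · intro k _ hk; simp [Pi.single_eq_of_ne hk]
  · simp

theorem partialZ_regPow (j : Fin n) {e : ℝ} (he : e ≠ 0) (b : ℝ) (p : Pt n) :
    partialZ j (regPow e b) p
      = 2 * b * (sqNorm p.1 * (starRingEnd ℂ) (p.1 j) * regPow e (b - 1) p) := by
  have h := partialZ_sqNorm j p
  rw [partialZ_eq] at h ⊢
  rw [dirDeriv_regPow _ _ _ _ he, h, dirDeriv_time]
  simp; ring

theorem partialZbar_regPow (j : Fin n) {e : ℝ} (he : e ≠ 0) (b : ℝ) (p : Pt n) :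
    partialZbar j (regPow e b) p = 2 * b * (sqNorm p.1 * p.1 j * regPow e (b - 1) p) := by
  have h := partialZbar_sqNorm j p
  rw [partialZbar_eq] at h ⊢
  rw [dirDeriv_regPow _ _ _ _ he, h, dirDeriv_time]
  simp; ring

theorem partialT_regPow {e : ℝ} (he : e ≠ 0) (b : ℝ) (p : Pt n) :
    partialT (regPow e b) p = 2 * b * (p.2 * regPow e (b - 1) p) := by
  rw [partialT_eq, dirDeriv_regPow _ _ _ _ he, dirDeriv_sqNorm, dirDeriv_time]
  simp; ring

/-- The operators that are complex combinations of two directional derivatives. -/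
def IsDirDeriv (D : (Pt n → ℂ) → Pt n → ℂ) : Prop := ∃ c d v w, D = dirDeriv c d v w

theorem isDirDeriv_partialZ (j : Fin n) : IsDirDeriv (partialZ j) := ⟨_, _, _, _, partialZ_eq j⟩

theorem isDirDeriv_partialZbar (j : Fin n) : IsDirDeriv (partialZbar j) :=
  ⟨_, _, _, _, partialZbar_eq j⟩

theorem isDirDeriv_partialT : IsDirDeriv (partialT (n := n)) := ⟨_, _, _, _, partialT_eq⟩

namespace IsDirDeriv

variable {D : (Pt n → ℂ) → Pt n → ℂ}

theorem mul (hD : IsDirDeriv D) {f g : Pt n → ℂ} (hf : ContDiff ℝ ∞ f) (hg : ContDiff ℝ ∞ g)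
    (p : Pt n) : D (fun q => f q * g q) p = D f p * g p + f p * D g p := by
  obtain ⟨c, d, v, w, rfl⟩ := hD
  exact dirDeriv_mul _ _ _ _ (hf.differentiable (by simp) p) (hg.differentiable (by simp) p)

theorem const_mul (hD : IsDirDeriv D) (a : ℂ) {g : Pt n → ℂ} (hg : ContDiff ℝ ∞ g)
    (p : Pt n) : D (fun q => a * g q) p = a * D g p := by
  rw [hD.mul contDiff_const hg]
  obtain ⟨c, d, v, w, rfl⟩ := hD
  rw [dirDeriv_const, zero_mul, zero_add]

theorem contDiff (hD : IsDirDeriv D) {f : Pt n → ℂ} (hf : ContDiff ℝ ∞ f) :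
    ContDiff ℝ ∞ (D f) := by
  obtain ⟨c, d, v, w, rfl⟩ := hD
  exact contDiff_dirDeriv _ _ _ _ hf

theorem hasCompactSupport (hD : IsDirDeriv D) {f : Pt n → ℂ} (hf : HasCompactSupport f) :
    HasCompactSupport (D f) := by
  obtain ⟨c, d, v, w, rfl⟩ := hD
  exact hasCompactSupport_dirDeriv _ _ _ _ hf

theorem integral_mul (hD : IsDirDeriv D) {f g : Pt n → ℂ} (hf : ContDiff ℝ ∞ f)
    (hfc : HasCompactSupport f) (hg : ContDiff ℝ ∞ g) :
    ∫ p, D f p * g p = -∫ p, f p * D g p := by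
  obtain ⟨c, d, v, w, rfl⟩ := hD
  exact integral_dirDeriv_mul _ _ _ _ hf hfc hg

end IsDirDeriv

theorem partialT_coord (j : Fin n) (p : Pt n) : partialT (fun q => q.1 j) p = 0 := by
  rw [partialT_eq, dirDeriv_coord]; simp

theorem partialT_conj_coord (j : Fin n) (p : Pt n) :
    partialT (fun q => (starRingEnd ℂ) (q.1 j)) p = 0 := by
  rw [partialT_eq, dirDeriv_conj_coord]; simp

theorem partialT_time (p : Pt n) : partialT (fun q => (q.2 : ℂ)) p = 1 := by
  rw [partialT_eq, dirDeriv_time]; simp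

theorem partialZ_time (j : Fin n) (p : Pt n) : partialZ j (fun q => (q.2 : ℂ)) p = 0 := by
  rw [partialZ_eq, dirDeriv_time]; simp

theorem partialZbar_time (j : Fin n) (p : Pt n) : partialZbar j (fun q => (q.2 : ℂ)) p = 0 := by
  rw [partialZbar_eq, dirDeriv_time]; simp

theorem contDiff_ofReal_sqNorm : ContDiff ℝ ∞ fun q : Pt n => (sqNorm q.1 : ℂ) :=
  Complex.ofRealCLM.contDiff.comp contDiff_sqNorm

theorem contDiff_ofReal_time : ContDiff ℝ ∞ fun q : Pt n => (q.2 : ℂ) :=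
  Complex.ofRealCLM.contDiff.comp contDiff_snd

theorem partialZbar_partialZ_regPow (j : Fin n) {e : ℝ} (he : e ≠ 0) (b : ℝ) (p : Pt n) :
    partialZbar j (partialZ j (regPow e b)) p
      = 2 * b * ((p.1 j * (starRingEnd ℂ) (p.1 j) + sqNorm p.1) * regPow e (b - 1) p
        + 2 * (b - 1) * sqNorm p.1 ^ 2 * (p.1 j * (starRingEnd ℂ) (p.1 j))
          * regPow e (b - 2) p) := by
  have hD := isDirDeriv_partialZbar j
  have h1 := contDiff_ofReal_sqNorm (n := n)
  have h2 := contDiff_conj_coord j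
  have h3 := contDiff_regPow (n := n) he (b - 1)
  rw [funext (partialZ_regPow j he b), hD.const_mul _ ((h1.mul h2).mul h3),
    hD.mul (h1.mul h2) h3, hD.mul h1 h2, partialZbar_sqNorm, partialZbar_conj_coord,
    partialZbar_regPow j he, show b - 1 - 1 = b - 2 by ring]
  push_cast
  ring

theorem partialT_partialT_mul_regPow (j : Fin n) {e : ℝ} (he : e ≠ 0) (b : ℝ) (p : Pt n) :
    partialT (partialT fun q => q.1 j * (starRingEnd ℂ) (q.1 j) * regPow e b q) p
      = p.1 j * (starRingEnd ℂ) (p.1 j) * (2 * b * (regPow e (b - 1) p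
        + 2 * (b - 1) * (p.2 : ℂ) ^ 2 * regPow e (b - 2) p)) := by
  have hD := isDirDeriv_partialT (n := n)
  have h1 := contDiff_coord j
  have h2 := contDiff_conj_coord j
  have ht := contDiff_ofReal_time (n := n)
  have h3 := contDiff_regPow (n := n) he (b - 1)
  have hT : ∀ (g : Pt n → ℂ), ContDiff ℝ ∞ g → ∀ q : Pt n,
      partialT (fun q => q.1 j * (starRingEnd ℂ) (q.1 j) * g q) q
        = q.1 j * (starRingEnd ℂ) (q.1 j) * partialT g q := fun g hg q => by
    rw [hD.mul (h1.mul h2) hg, hD.mul h1 h2, partialT_coord, partialT_conj_coord]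
    ring
  rw [funext (hT _ (contDiff_regPow he b)), hT _ (hD.contDiff (contDiff_regPow he b)),
    funext (partialT_regPow he b), hD.const_mul _ (ht.mul h3), hD.mul ht h3, partialT_time,
    partialT_regPow he, show b - 1 - 1 = b - 2 by ring]
  push_cast
  ring

/-- The gauge depends on z only through |z|², so z_j ∂/∂z_j and its conjugate agree on it. This is
the infinitesimal rotation invariance that kills the mixed term of the sub-Laplacian. -/
theorem partialZ_coord_mul_partialT_regPow (j : Fin n) {e : ℝ} (he : e ≠ 0) (b : ℝ) (p : Pt n) :
    partialZ j (fun q => q.1 j * partialT (regPow e b) q) p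
      = partialZbar j (fun q => (starRingEnd ℂ) (q.1 j) * partialT (regPow e b) q) p := by
  have hZ := isDirDeriv_partialZ j
  have hW := isDirDeriv_partialZbar j
  have h1 := contDiff_coord j
  have h2 := contDiff_conj_coord j
  have ht := contDiff_ofReal_time (n := n)
  have h3 := contDiff_regPow (n := n) he (b - 1)
  rw [funext (partialT_regPow he b), hZ.mul h1 (contDiff_const.mul (ht.mul h3)),
    hW.mul h2 (contDiff_const.mul (ht.mul h3)), hZ.const_mul _ (ht.mul h3),
    hW.const_mul _ (ht.mul h3), hZ.mul ht h3, hW.mul ht h3, partialZ_coord,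
    partialZbar_conj_coord, partialZ_time, partialZbar_time, partialZ_regPow j he,
    partialZbar_regPow j he]
  ring

/-! ### Moving the sub-Laplacian onto the regularized power. -/

section TestFunction

variable {φ : Pt n → ℂ}

theorem contDiff_subLaplacian (hφ : ContDiff ℝ ∞ φ) : ContDiff ℝ ∞ (subLaplacian φ) := by
  have hT := isDirDeriv_partialT (n := n)
  refine ContDiff.sum fun j _ => ?_
  have hZ := isDirDeriv_partialZ j
  have hW := isDirDeriv_partialZbar j
  refine ((hZ.contDiff (hW.contDiff hφ)).neg.sub (ContDiff.mul ?_
    (hT.contDiff (hT.contDiff hφ)))).add (contDiff_const.mul (hT.contDiff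
      (((contDiff_coord j).mul (hZ.contDiff hφ)).sub
        ((contDiff_conj_coord j).mul (hW.contDiff hφ)))))
  exact Complex.ofRealCLM.contDiff.comp ((contDiff_norm_sq ℝ).comp (contDiff_coord j))

theorem hasCompactSupport_finset_sum {ι : Type*} (s : Finset ι) {f : ι → Pt n → ℂ}
    (hf : ∀ i, HasCompactSupport (f i)) : HasCompactSupport fun p => ∑ i ∈ s, f i p := by
  classical
  induction s using Finset.induction_on with
  | empty => exact HasCompactSupport.zero
  | insert i s his ih =>
    simp only [Finset.sum_insert his]
    exact (hf i).add ih

theorem hasCompactSupport_rotation (hφc : HasCompactSupport φ) (j : Fin n) :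
    HasCompactSupport fun q : Pt n => q.1 j * partialZ j φ q
      - (starRingEnd ℂ) (q.1 j) * partialZbar j φ q :=
  ((isDirDeriv_partialZ j).hasCompactSupport hφc).mul_left.sub
    ((isDirDeriv_partialZbar j).hasCompactSupport hφc).mul_left

theorem hasCompactSupport_subLaplacian (hφc : HasCompactSupport φ) :
    HasCompactSupport (subLaplacian φ) := by
  have hT := isDirDeriv_partialT (n := n)
  refine hasCompactSupport_finset_sum _ fun j => ?_
  have hZ := isDirDeriv_partialZ j
  have hW := isDirDeriv_partialZbar j
  exact ((hZ.hasCompactSupport (hW.hasCompactSupport hφc)).neg.sub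
    (hT.hasCompactSupport (hT.hasCompactSupport hφc)).mul_left).add
      (hT.hasCompactSupport (hasCompactSupport_rotation hφc j)).mul_left

theorem integral_partialZ_partialZbar_mul (hφ : ContDiff ℝ ∞ φ) (hφc : HasCompactSupport φ)
    (j : Fin n) {g : Pt n → ℂ} (hg : ContDiff ℝ ∞ g) :
    ∫ p, partialZ j (partialZbar j φ) p * g p = ∫ p, φ p * partialZbar j (partialZ j g) p := by
  have hZ := isDirDeriv_partialZ j
  have hW := isDirDeriv_partialZbar j
  rw [hZ.integral_mul (hW.contDiff hφ) (hW.hasCompactSupport hφc) hg,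
    hW.integral_mul hφ hφc (hZ.contDiff hg), neg_neg]

theorem integral_partialT_partialT_mul (hφ : ContDiff ℝ ∞ φ) (hφc : HasCompactSupport φ)
    {g : Pt n → ℂ} (hg : ContDiff ℝ ∞ g) :
    ∫ p, partialT (partialT φ) p * g p = ∫ p, φ p * partialT (partialT g) p := by
  have hT := isDirDeriv_partialT (n := n)
  rw [hT.integral_mul (hT.contDiff hφ) (hT.hasCompactSupport hφc) hg,
    hT.integral_mul hφ hφc (hT.contDiff hg), neg_neg]

theorem integral_partialT_rotation_mul_regPow (hφ : ContDiff ℝ ∞ φ) (hφc : HasCompactSupport φ)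
    (j : Fin n) {e : ℝ} (he : e ≠ 0) (b : ℝ) :
    ∫ p, partialT (fun q => q.1 j * partialZ j φ q
      - (starRingEnd ℂ) (q.1 j) * partialZbar j φ q) p * regPow e b p = 0 := by
  have hT := isDirDeriv_partialT (n := n)
  have hZ := isDirDeriv_partialZ j
  have hW := isDirDeriv_partialZbar j
  have h1 := contDiff_coord j
  have h2 := contDiff_conj_coord j
  have hP := contDiff_regPow (n := n) he b
  have hTP := hT.contDiff hP
  rw [hT.integral_mul ((h1.mul (hZ.contDiff hφ)).sub (h2.mul (hW.contDiff hφ)))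
    (hasCompactSupport_rotation hφc j) hP, neg_eq_zero]
  have e1 : ∀ p : Pt n, (p.1 j * partialZ j φ p - (starRingEnd ℂ) (p.1 j) * partialZbar j φ p)
        * partialT (regPow e b) p
      = partialZ j φ p * (p.1 j * partialT (regPow e b) p)
        - partialZbar j φ p * ((starRingEnd ℂ) (p.1 j) * partialT (regPow e b) p) := fun p => by
    ring
  simp only [e1]
  rw [integral_sub
    (integrable_mul_of_hasCompactSupport (hZ.contDiff hφ).continuous (hZ.hasCompactSupport hφc)
      (h1.mul hTP).continuous)
    (integrable_mul_of_hasCompactSupport (hW.contDiff hφ).continuous (hW.hasCompactSupport hφc)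
      (h2.mul hTP).continuous),
    hZ.integral_mul hφ hφc (h1.mul hTP), hW.integral_mul hφ hφc (h2.mul hTP)]
  simp only [partialZ_coord_mul_partialT_regPow j he, sub_self]

/-- The mixed term drops out for each j, and two integrations by parts move the others. The weight
|z_j|² does not depend on t, and is grouped with the power before the t-derivatives are moved. -/
theorem integral_subLaplacian_mul_regPow (hφ : ContDiff ℝ ∞ φ) (hφc : HasCompactSupport φ)
    {e : ℝ} (he : e ≠ 0) :
    ∫ p, subLaplacian φ p * regPow e (-(n : ℝ) / 2) p
      = ∫ p, φ p * (n * (n + 2) * sqNorm p.1 * (e : ℂ) ^ 2 * regPow e (-((n : ℝ) + 4) / 2) p) := by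
  set b : ℝ := -(n : ℝ) / 2 with hb
  have hT := isDirDeriv_partialT (n := n)
  have hP := contDiff_regPow (n := n) he b
  have hzz : ∀ j : Fin n, ContDiff ℝ ∞ fun q : Pt n =>
      q.1 j * (starRingEnd ℂ) (q.1 j) * regPow e b q := fun j =>
    ((contDiff_coord j).mul (contDiff_conj_coord j)).mul hP
  have hsplit : ∀ p : Pt n, subLaplacian φ p * regPow e b p
      = ∑ j, (-(partialZ j (partialZbar j φ) p * regPow e b p)
        - partialT (partialT φ) p * (p.1 j * (starRingEnd ℂ) (p.1 j) * regPow e b p)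
        + Complex.I * (partialT (fun q => q.1 j * partialZ j φ q
          - (starRingEnd ℂ) (q.1 j) * partialZbar j φ q) p * regPow e b p)) := fun p => by
    rw [subLaplacian, Finset.sum_mul]
    refine Finset.sum_congr rfl fun j _ => ?_
    rw [Complex.mul_conj']
    push_cast
    ring
  have i1 : ∀ j : Fin n, Integrable fun p => partialZ j (partialZbar j φ) p * regPow e b p :=
    fun j => by
      have hZ := isDirDeriv_partialZ j
      have hW := isDirDeriv_partialZbar j
      exact integrable_mul_of_hasCompactSupport (hZ.contDiff (hW.contDiff hφ)).continuous
        (hZ.hasCompactSupport (hW.hasCompactSupport hφc)) hP.continuous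
  have i2 : ∀ j : Fin n, Integrable fun p : Pt n => partialT (partialT φ) p
      * (p.1 j * (starRingEnd ℂ) (p.1 j) * regPow e b p) := fun j =>
    integrable_mul_of_hasCompactSupport (hT.contDiff (hT.contDiff hφ)).continuous
        (hT.hasCompactSupport (hT.hasCompactSupport hφc)) (hzz j).continuous
  have i3 : ∀ j : Fin n, Integrable fun p => partialT (fun q => q.1 j * partialZ j φ q
      - (starRingEnd ℂ) (q.1 j) * partialZbar j φ q) p * regPow e b p := fun j =>
    integrable_mul_of_hasCompactSupport (hT.contDiff
      (((contDiff_coord j).mul ((isDirDeriv_partialZ j).contDiff hφ)).sub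
        ((contDiff_conj_coord j).mul ((isDirDeriv_partialZbar j).contDiff hφ)))).continuous
        (hT.hasCompactSupport (hasCompactSupport_rotation hφc j)) hP.continuous
  have k1 : ∀ j : Fin n, Integrable fun p => φ p * partialZbar j (partialZ j (regPow e b)) p :=
    fun j => integrable_mul_of_hasCompactSupport hφ.continuous hφc
      ((isDirDeriv_partialZbar j).contDiff ((isDirDeriv_partialZ j).contDiff hP)).continuous
  have k2 : ∀ j : Fin n, Integrable fun p => φ p
      * partialT (partialT fun q => q.1 j * (starRingEnd ℂ) (q.1 j) * regPow e b q) p :=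
    fun j => integrable_mul_of_hasCompactSupport hφ.continuous hφc
      (hT.contDiff (hT.contDiff (hzz j))).continuous
  simp only [hsplit]
  rw [integral_finsetSum _ fun j _ => ((i1 j).fun_neg.sub' (i2 j)).fun_add ((i3 j).const_mul _)]
  have hterm : ∀ j : Fin n, ∫ p : Pt n, (-(partialZ j (partialZbar j φ) p * regPow e b p)
        - partialT (partialT φ) p * (p.1 j * (starRingEnd ℂ) (p.1 j) * regPow e b p)
        + Complex.I * (partialT (fun q => q.1 j * partialZ j φ q
          - (starRingEnd ℂ) (q.1 j) * partialZbar j φ q) p * regPow e b p))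
      = ∫ p : Pt n, (-(φ p * partialZbar j (partialZ j (regPow e b)) p) - φ p
      * partialT (partialT fun q => q.1 j * (starRingEnd ℂ) (q.1 j) * regPow e b q) p) := fun j => by
    rw [integral_add ((i1 j).fun_neg.sub' (i2 j)) ((i3 j).const_mul _), integral_const_mul,
      integral_partialT_rotation_mul_regPow hφ hφc j he, mul_zero, add_zero,
      integral_sub (i1 j).fun_neg (i2 j), integral_neg, integral_partialZ_partialZbar_mul hφ hφc j hP,
      integral_partialT_partialT_mul hφ hφc (hzz j), ← integral_neg,
      ← integral_sub (k1 j).fun_neg (k2 j)]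
  rw [Finset.sum_congr rfl fun j _ => hterm j,
    ← integral_finsetSum _ fun j _ => (k1 j).fun_neg.sub' (k2 j)]
  refine integral_congr_ae (ae_of_all _ fun p => ?_)
  simp only [partialZbar_partialZ_regPow _ he, partialT_partialT_mul_regPow _ he]
  have hR := regPow_sub_one he (b - 1) p
  rw [show b - 1 - 1 = b - 2 by ring] at hR
  have hB : -((n : ℝ) + 4) / 2 = b - 2 := by rw [hb]; ring
  have hbn : (b : ℂ) = -(n : ℂ) / 2 := by rw [hb]; push_cast; rfl
  rw [hB, hR]
  generalize regPow e (b - 2) p = R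
  have e2 : ∀ j : Fin n, -(φ p * (2 * ↑b * ((p.1 j * (starRingEnd ℂ) (p.1 j) + ↑(sqNorm p.1))
          * (((sqNorm p.1 : ℂ) ^ 2 + (p.2 : ℂ) ^ 2 + (e : ℂ) ^ 2) * R)
        + 2 * (↑b - 1) * ↑(sqNorm p.1) ^ 2 * (p.1 j * (starRingEnd ℂ) (p.1 j)) * R)))
      - φ p * (p.1 j * (starRingEnd ℂ) (p.1 j) * (2 * ↑b
        * (((sqNorm p.1 : ℂ) ^ 2 + (p.2 : ℂ) ^ 2 + (e : ℂ) ^ 2) * R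
          + 2 * (↑b - 1) * (p.2 : ℂ) ^ 2 * R)))
      = (-2 * φ p * b * R * (2 * ((sqNorm p.1 : ℂ) ^ 2 + (p.2 : ℂ) ^ 2 + (e : ℂ) ^ 2)
          + 2 * (b - 1) * ((sqNorm p.1 : ℂ) ^ 2 + (p.2 : ℂ) ^ 2)))
            * (p.1 j * (starRingEnd ℂ) (p.1 j))
        + -2 * φ p * b * R * sqNorm p.1
          * ((sqNorm p.1 : ℂ) ^ 2 + (p.2 : ℂ) ^ 2 + (e : ℂ) ^ 2) := fun j => by ring
  simp only [e2]
  -- Let Q be the regularized gauge. Summing over j gives -2b|z|² [(n+2)Q + 2(b-1)(|z|⁴+t²)]. For b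
  -- = -n/2 one has 2(b-1) = -(n+2), so the bracket collapses to (n+2)e².
  rw [Finset.sum_add_distrib, ← Finset.mul_sum, ← ofReal_sqNorm, Finset.sum_const,
    Finset.card_univ, Fintype.card_fin, nsmul_eq_mul, hbn]
  ring

end TestFunction

/-! ### Local integrability of the singular power and removal of the regularization. -/

theorem norm_sq_le_sqNorm (z : Fin n → ℂ) : ‖z‖ ^ 2 ≤ sqNorm z := by
  rw [← Real.le_sqrt (norm_nonneg z) (sqNorm_nonneg z),
    pi_norm_le_iff_of_nonneg (Real.sqrt_nonneg _)]
  intro j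
  rw [Real.le_sqrt (norm_nonneg _) (sqNorm_nonneg z)]
  exact Finset.single_le_sum (f := fun j => ‖z j‖ ^ 2) (fun i _ => by positivity)
    (Finset.mem_univ j)

theorem regGauge_zero (p : Pt n) : regGauge 0 p = sqNorm p.1 ^ 2 + p.2 ^ 2 := by
  simp [regGauge]

theorem regGauge_zero_pos {p : Pt n} (hp : p.2 ≠ 0) : 0 < regGauge 0 p := by
  rw [regGauge_zero]; positivity

theorem follandG_eq (p : Pt n) :
    follandG p = follandConst n * regGauge 0 p ^ (-(n : ℝ) / 2) := by
  rw [follandG, homNorm, regGauge_zero, ← Real.rpow_mul (by positivity)]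
  congr 2
  ring

theorem ae_fst_ne_zero (hn : 1 ≤ n) : ∀ᵐ p : Pt n, p.1 ≠ 0 := by
  have : NeZero n := ⟨by omega⟩
  exact Measure.quasiMeasurePreserving_fst.ae (Measure.ae_ne volume 0)

theorem ae_snd_ne_zero : ∀ᵐ p : Pt n, p.2 ≠ 0 :=
  Measure.quasiMeasurePreserving_snd.ae (Measure.ae_ne volume 0)

/-- The exponent is split as n/2 = (2n-1)/4 + 1/4, using |z|⁴ for the first part and t² for the
second. Both resulting factors are locally integrable, since 2n-1 < 2n on ℂⁿ and 1/2 < 1 on ℝ. -/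
theorem regGauge_zero_rpow_le (hn : 1 ≤ n) {p : Pt n} (h1 : p.1 ≠ 0) (h2 : p.2 ≠ 0) :
    regGauge 0 p ^ (-(n : ℝ) / 2) ≤ ‖p.1‖ ^ (-(2 * (n : ℝ) - 1)) * ‖p.2‖ ^ (-(1 / 2 : ℝ)) := by
  have hn' : (1 : ℝ) ≤ n := by exact_mod_cast hn
  have hQ := regGauge_zero_pos h2
  have hz : 0 < ‖p.1‖ := norm_pos_iff.2 h1
  have ht : 0 < ‖p.2‖ := norm_pos_iff.2 h2
  have e1 : ‖p.1‖ ^ (4 : ℝ) ≤ regGauge 0 p := by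
    have := norm_sq_le_sqNorm p.1
    rw [regGauge_zero, show (4 : ℝ) = ((4 : ℕ) : ℝ) by norm_num, Real.rpow_natCast]
    calc ‖p.1‖ ^ 4 = (‖p.1‖ ^ 2) ^ 2 := by ring
      _ ≤ sqNorm p.1 ^ 2 := by gcongr
      _ ≤ _ := by linarith [sq_nonneg p.2]
  have e2 : ‖p.2‖ ^ (2 : ℝ) ≤ regGauge 0 p := by
    rw [regGauge_zero, show (2 : ℝ) = ((2 : ℕ) : ℝ) by norm_num, Real.rpow_natCast,
      Real.norm_eq_abs, sq_abs]
    linarith [sq_nonneg (sqNorm p.1)]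
  rw [show -(n : ℝ) / 2 = -(2 * n - 1) / 4 + -(1 / 4) by ring, Real.rpow_add hQ]
  refine mul_le_mul ?_ ?_ (by positivity) (by positivity)
  · refine (Real.rpow_le_rpow_of_nonpos (by positivity) e1 (by linarith)).trans_eq ?_
    rw [← Real.rpow_mul hz.le]; congr 1; ring
  · refine (Real.rpow_le_rpow_of_nonpos (by positivity) e2 (by norm_num)).trans_eq ?_
    rw [← Real.rpow_mul ht.le]; congr 1; ring

theorem integrableOn_norm_rpow_ball {E : Type*} [NormedAddCommGroup E] [NormedSpace ℝ E]
    [FiniteDimensional ℝ E] [Nontrivial E] [MeasurableSpace E] [BorelSpace E] (μ : Measure E)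
    [μ.IsAddHaarMeasure] {a : ℝ} (ha : a < Module.finrank ℝ E) (R : ℝ) :
    IntegrableOn (fun x : E => ‖x‖ ^ (-a)) (Metric.ball 0 R) μ := by
  have hd : 0 < Module.finrank ℝ E := Module.finrank_pos
  rw [integrableOn_fun_norm_addHaar μ (f := fun r : ℝ => r ^ (-a))]
  refine IntegrableOn.congr_fun (f := fun r : ℝ => r ^ ((Module.finrank ℝ E : ℝ) - 1 - a)) ?_
    (fun r hr => ?_) measurableSet_Ioo
  · rcases le_or_gt R 0 with hR | hR
    · simp [Ioo_eq_empty_of_le hR]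
    · rw [intervalIntegral.integrableOn_Ioo_rpow_iff hR]
      linarith
  · have hr : 0 < r := hr.1
    simp only [smul_eq_mul]
    rw [← Real.rpow_natCast, ← Real.rpow_add hr, Nat.cast_sub hd]
    congr 1
    push_cast; ring

theorem measurable_regGauge (e : ℝ) : Measurable (regGauge (n := n) e) :=
  (contDiff_regGauge e).continuous.measurable

theorem integrableOn_regGauge_zero_rpow_ball (hn : 1 ≤ n) (R : ℝ) :
    IntegrableOn (fun p : Pt n => regGauge 0 p ^ (-(n : ℝ) / 2)) (Metric.ball 0 R) := by
  have : NeZero n := ⟨by omega⟩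
  have h1 := integrableOn_norm_rpow_ball (volume : Measure (Fin n → ℂ)) (a := 2 * (n : ℝ) - 1)
    (by rw [Module.finrank_pi_fintype]; simp [Complex.finrank_real_complex, mul_comm]) R
  have h2 := integrableOn_norm_rpow_ball (volume : Measure ℝ) (a := 1 / 2)
    (by simp; norm_num) R
  have h3 := Integrable.mul_prod h1 h2
  rw [Measure.prod_restrict, ← Measure.volume_eq_prod, ball_prod_same] at h3
  refine Integrable.mono' h3 ((measurable_regGauge 0).pow_const _).aestronglyMeasurable ?_
  filter_upwards [ae_restrict_of_ae (ae_fst_ne_zero hn), ae_restrict_of_ae ae_snd_ne_zero]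
    with p hp1 hp2
  rw [Real.norm_of_nonneg (Real.rpow_nonneg (regGauge_zero_pos hp2).le _)]
  exact regGauge_zero_rpow_le hn hp1 hp2

theorem integrable_mul_regPow_zero (hn : 1 ≤ n) {u : Pt n → ℂ} (hu : Continuous u)
    (huc : HasCompactSupport u) : Integrable fun p => u p * regPow 0 (-(n : ℝ) / 2) p := by
  obtain ⟨R, hR⟩ := huc.isCompact.isBounded.subset_ball 0
  obtain ⟨C, hC⟩ := huc.exists_bound_of_continuous hu
  rw [← integrableOn_iff_integrable_of_support_subset (s := Metric.ball 0 R)]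
  · exact Integrable.bdd_mul (integrableOn_regGauge_zero_rpow_ball hn R).ofReal
      hu.aestronglyMeasurable (ae_of_all _ hC)
  · intro p hp
    exact hR (subset_tsupport _ (left_ne_zero_of_mul hp))

theorem tendsto_integral_mul_regPow (hn : 1 ≤ n) {u : Pt n → ℂ} (hu : Continuous u)
    (huc : HasCompactSupport u) :
    Tendsto (fun ε : ℝ => ∫ p, u p * regPow (ε ^ 2) (-(n : ℝ) / 2) p) (𝓝[>] 0)
      (𝓝 (∫ p, u p * regPow 0 (-(n : ℝ) / 2) p)) := by
  refine tendsto_integral_filter_of_dominated_convergence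
    (fun p => ‖u p * regPow 0 (-(n : ℝ) / 2) p‖) ?_ ?_ (integrable_mul_regPow_zero hn hu huc).norm ?_
  · refine Eventually.of_forall fun ε => hu.aestronglyMeasurable.mul ?_
    exact (Complex.measurable_ofReal.comp
      ((measurable_regGauge _).pow_const _)).aestronglyMeasurable
  · refine Eventually.of_forall fun ε => ?_
    -- The origin must be excluded: there the unregularized power takes the default value 0 and is
    -- no majorant. Elsewhere the gauge grows with the regularization and the exponent is
    -- nonpositive.
    filter_upwards [ae_snd_ne_zero] with p hp
    have h0 := regGauge_zero_pos hp
    have hle : regGauge 0 p ≤ regGauge (ε ^ 2) p := by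
      simp only [regGauge]
      linarith [sq_nonneg (ε ^ 2)]
    simp only [norm_mul, regPow, Complex.norm_real]
    rw [Real.norm_of_nonneg (Real.rpow_nonneg h0.le _),
      Real.norm_of_nonneg (Real.rpow_nonneg (h0.le.trans hle) _)]
    refine mul_le_mul_of_nonneg_left ?_ (norm_nonneg _)
    refine Real.rpow_le_rpow_of_nonpos h0 hle ?_
    have : (0 : ℝ) ≤ n := by positivity
    linarith
  · filter_upwards [ae_snd_ne_zero] with p hp
    have h0 := regGauge_zero_pos hp
    refine Tendsto.const_mul _ ((Complex.continuous_ofReal.tendsto _).comp ?_)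
    refine Tendsto.rpow_const ?_ (Or.inl h0.ne')
    have : Continuous fun ε : ℝ => regGauge (ε ^ 2) p := by unfold regGauge; fun_prop
    have h := (this.tendsto 0).mono_left (nhdsWithin_le_nhds (s := Ioi 0))
    simpa using h

/-! ### Dilations and the limit at the origin. -/

/-- The automorphic dilation `(z, t) ↦ (ε z, ε² t)`. -/
noncomputable def dilation (ε : ℝ) (p : Pt n) : Pt n := (ε • p.1, ε ^ 2 • p.2)

theorem integral_comp_dilation {ε : ℝ} (hε : 0 < ε) (f : Pt n → ℂ) :
    ∫ p, f p = ((ε ^ (2 * n + 2) : ℝ) : ℂ) * ∫ p, f (dilation ε p) := by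
  have hε2 : (ε ^ 2) ≠ 0 := by positivity
  have hemb : MeasurableEmbedding (dilation (n := n) ε) :=
    ((Homeomorph.smulOfNeZero ε hε.ne').prodCongr
      (Homeomorph.smulOfNeZero (ε ^ 2) hε2)).measurableEmbedding
  have hmap : Measure.map (dilation (n := n) ε) volume
      = ENNReal.ofReal ((ε ^ (2 * n + 2))⁻¹) • volume := by
    have hd : Module.finrank ℝ (Fin n → ℂ) = 2 * n := by
      rw [Module.finrank_pi_fintype]; simp [Complex.finrank_real_complex, mul_comm]
    have := Measure.map_prod_map (volume : Measure (Fin n → ℂ)) (volume : Measure ℝ)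
      (measurable_const_smul ε) (measurable_const_smul (ε ^ 2))
    rw [Measure.map_addHaar_smul _ hε.ne', Measure.map_addHaar_smul _ hε2,
      Measure.prod_smul_left, Measure.prod_smul_right, smul_smul,
      ← ENNReal.ofReal_mul (abs_nonneg _), hd, Module.finrank_self, abs_of_pos (by positivity),
      abs_of_pos (by positivity), pow_one, ← mul_inv, ← pow_add] at this
    exact this.symm
  rw [← hemb.integral_map, hmap, integral_smul_measure, ENNReal.toReal_ofReal (by positivity),
    Complex.real_smul, ← mul_assoc, ← Complex.ofReal_mul, mul_inv_cancel₀ (by positivity),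
    Complex.ofReal_one, one_mul]

theorem follandConst_pos (hn : 1 ≤ n) : 0 < follandConst n := by
  have hn' : (0 : ℝ) < n := by exact_mod_cast hn
  have := Real.Gamma_pos_of_pos (show 0 < (n : ℝ) / 2 by positivity)
  have := Real.pi_pos
  rw [follandConst_eq hn]
  positivity

/-- The density whose integral is the reciprocal of Folland's constant. -/
noncomputable def follandDensity (p : Pt n) : ℝ :=
  n * (n + 2) * (sqNorm p.1 * (sqNorm p.1 ^ 2 + p.2 ^ 2 + 1) ^ (-((n : ℝ) + 4) / 2))

theorem integral_follandDensity_eq_inv : ∫ p : Pt n, follandDensity p = (follandConst n)⁻¹ := by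
  simp only [follandDensity]
  rw [integral_const_mul, follandConst, inv_inv]

/-- The integral is 1/c_n, which the closed form shows to be nonzero, and a non-integrable function
would have integral 0. -/
theorem integrable_follandDensity (hn : 1 ≤ n) : Integrable (follandDensity (n := n)) := by
  refine not_imp_comm.1 integral_undef fun h => ?_
  rw [integral_follandDensity_eq_inv] at h
  exact (inv_pos.2 (follandConst_pos hn)).ne' h

theorem integral_mul_regPow_eq_dilation (φ : Pt n → ℂ) {ε : ℝ} (hε : 0 < ε) :
    ∫ p, φ p * (n * (n + 2) * sqNorm p.1 * ((ε ^ 2 : ℝ) : ℂ) ^ 2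
        * regPow (ε ^ 2) (-((n : ℝ) + 4) / 2) p)
      = ∫ p, φ (dilation ε p) * (follandDensity p : ℂ) := by
  rw [integral_comp_dilation hε, ← integral_const_mul]
  refine integral_congr_ae (ae_of_all _ fun p => ?_)
  have hs : sqNorm (dilation ε p).1 = ε ^ 2 * sqNorm p.1 := by
    simp only [sqNorm, dilation, Pi.smul_apply, norm_smul, Real.norm_of_nonneg hε.le, mul_pow,
      Finset.mul_sum]
  have hQ : regGauge (ε ^ 2) (dilation ε p)
      = ε ^ 4 * (sqNorm p.1 ^ 2 + p.2 ^ 2 + 1) := by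
    rw [regGauge, hs]
    simp only [dilation, smul_eq_mul]
    ring
  -- The powers of ε balance: 2n+2 from the Jacobian, 2 from |z|², 4 from the squared regularization
  -- parameter, and -2(n+4) from the gauge.
  have hpow : ε ^ (2 * n + 2) * (ε ^ 2 * (ε ^ 2) ^ 2) * (ε ^ 4) ^ (-((n : ℝ) + 4) / 2) = 1 := by
    have : ε ^ (2 * n + 2) * (ε ^ 2 * (ε ^ 2) ^ 2) = ε ^ (2 * n + 8) := by ring
    rw [this, ← Real.rpow_natCast, ← Real.rpow_natCast, ← Real.rpow_mul hε.le, ← Real.rpow_add hε,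
      show ((2 * n + 8 : ℕ) : ℝ) + ((4 : ℕ) : ℝ) * (-((n : ℝ) + 4) / 2) = 0 by push_cast; ring,
      Real.rpow_zero]
  have hpow' := congrArg (fun x : ℝ => (x : ℂ)) hpow
  simp only [regPow, hs, hQ, follandDensity]
  rw [Real.mul_rpow (by positivity) (by positivity)]
  push_cast at hpow' ⊢
  linear_combination (φ (dilation ε p) * n * (n + 2) * sqNorm p.1
    * (((sqNorm p.1 ^ 2 + p.2 ^ 2 + 1) ^ (-((n : ℝ) + 4) / 2) : ℝ) : ℂ)) * hpow'

/-- An approximate identity: φ is bounded and continuous, the density is integrable, and the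
dilations contract every point to 0. -/
theorem tendsto_integral_comp_dilation (hn : 1 ≤ n) {φ : Pt n → ℂ} (hφ : Continuous φ)
    (hφc : HasCompactSupport φ) :
    Tendsto (fun ε : ℝ => ∫ p, φ (dilation ε p) * (follandDensity p : ℂ)) (𝓝[>] 0)
      (𝓝 (φ 0 * (((follandConst n)⁻¹ : ℝ) : ℂ))) := by
  obtain ⟨C, hC⟩ := hφc.exists_bound_of_continuous hφ
  have hI := (integrable_follandDensity hn).ofReal (𝕜 := ℂ)
  have hlim : ∫ p : Pt n, φ 0 * (follandDensity p : ℂ) = φ 0 * (((follandConst n)⁻¹ : ℝ) : ℂ) := by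
    rw [integral_const_mul, integral_complex_ofReal, integral_follandDensity_eq_inv]
  rw [← hlim]
  have hdil : ∀ ε, Continuous (dilation (n := n) ε) := fun ε => by unfold dilation; fun_prop
  refine tendsto_integral_filter_of_dominated_convergence
    (fun p => C * ‖(follandDensity p : ℂ)‖)
    (Eventually.of_forall fun ε => (hφ.comp (hdil ε)).aestronglyMeasurable.mul
      hI.aestronglyMeasurable)
    (Eventually.of_forall fun ε => ae_of_all _ fun p => ?_) (hI.norm.const_mul C)
    (ae_of_all _ fun p => ?_)
  · rw [norm_mul]
    exact mul_le_mul_of_nonneg_right (hC _) (norm_nonneg _)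
  · refine Tendsto.mul_const _ (Tendsto.mono_left ?_ nhdsWithin_le_nhds)
    have : Continuous fun ε : ℝ => φ (dilation ε p) := hφ.comp (by unfold dilation; fun_prop)
    have h := this.tendsto 0
    simpa [dilation, ← Prod.zero_eq_mk] using h

/-- The same regularized integrals have two limits as ε → 0, one by removing the regularization and
one by concentration at the origin. -/
theorem integral_subLaplacian_mul_regPow_zero (hn : 1 ≤ n) {φ : Pt n → ℂ} (hφ : ContDiff ℝ ∞ φ)
    (hφc : HasCompactSupport φ) :
    ∫ p, subLaplacian φ p * regPow 0 (-(n : ℝ) / 2) p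
      = φ 0 * (((follandConst n)⁻¹ : ℝ) : ℂ) := by
  refine tendsto_nhds_unique (tendsto_integral_mul_regPow hn (contDiff_subLaplacian hφ).continuous
    (hasCompactSupport_subLaplacian hφc)) ?_
  refine (tendsto_integral_comp_dilation hn hφ.continuous hφc).congr' ?_
  filter_upwards [self_mem_nhdsWithin] with ε hε
  have hε : 0 < ε := hε
  rw [integral_subLaplacian_mul_regPow hφ hφc (by positivity), integral_mul_regPow_eq_dilation φ hε]

theorem subLaplacian_mul_follandG (φ : Pt n → ℂ) (p : Pt n) :
    subLaplacian φ p * (follandG p : ℂ)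
      = (follandConst n : ℂ) * (subLaplacian φ p * regPow 0 (-(n : ℝ) / 2) p) := by
  rw [follandG_eq, regPow, Complex.ofReal_mul]
  ring

/-- The sign in -w and the antisymmetry of Im⟨·,·⟩ compensate each other. -/
theorem follandG_mul_inv (p q : Pt n) : follandG (mul (inv q) p)
    = follandConst n * (sqNorm (p.1 - q.1) ^ 2
      + (p.2 - q.2 + 2 * (herm p.1 q.1).im) ^ 2) ^ (-(n : ℝ) / 2) := by
  have h1 : (herm (-q.1) p.1).im = (herm p.1 q.1).im := by
    simp only [herm, Complex.im_sum]
    refine Finset.sum_congr rfl fun j _ => ?_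
    simp
    ring
  rw [follandG_eq, regGauge_zero]
  simp only [mul, inv, h1]
  rw [neg_add_eq_sub, neg_add_eq_sub]

end Heisenberg

/-! ### Assembly and comparison of the constants. -/

theorem mainTheorem3 (n : ℕ) (hn : 1 ≤ n) :
    -- the value of the constant
    Heisenberg.follandConst n
        = 2 ^ ((n : ℝ) - 2) * Real.Gamma ((n : ℝ) / 2) ^ 2 / Real.pi ^ ((n : ℝ) + 1) ∧
    -- `G` is a fundamental solution of the sub-Laplacian with source at the origin
    (∀ φ : Heisenberg.Pt n → ℂ, ContDiff ℝ ∞ φ → HasCompactSupport φ →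
      Integrable (fun p => Heisenberg.subLaplacian φ p * (Heisenberg.follandG p : ℂ)) ∧
      ∫ p, Heisenberg.subLaplacian φ p * (Heisenberg.follandG p : ℂ) = φ 0) ∧
    -- the resolvent kernel at `ζ = 0`
    (∀ p q : Heisenberg.Pt n, p.1 ≠ q.1 →
      (∀ ζ : ℂ, ζ.re ≤ 0 →
        IntegrableOn (Heisenberg.resolventIntegrand ζ p q) (Ioi (0 : ℝ))) ∧
      Tendsto (fun ζ : ℂ => Heisenberg.resolventKernel ζ p q) (𝓝[{ζ : ℂ | ζ.re < 0}] 0)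
        (𝓝 (Heisenberg.resolventKernel 0 p q)) ∧
      -Heisenberg.resolventKernel 0 p q
        = ((2 ^ ((n : ℝ) - 1) * Real.Gamma ((n : ℝ) / 2) ^ 2
            / Real.pi ^ ((n : ℝ) + 1 / 2)
            * (Heisenberg.sqNorm (p.1 - q.1) ^ 2
                + (p.2 - q.2 + 2 * (Heisenberg.herm p.1 q.1).im) ^ 2) ^ (-(n : ℝ) / 2) : ℝ) : ℂ) ∧
      -Heisenberg.resolventKernel 0 p q
        = ((2 ^ ((n : ℝ) - 1) * Real.Gamma ((n : ℝ) / 2) ^ 2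
            / (Real.pi ^ ((n : ℝ) + 1 / 2) * Heisenberg.follandConst n)
            * Heisenberg.follandG (Heisenberg.mul (Heisenberg.inv q) p) : ℝ) : ℂ) ∧
      -Heisenberg.resolventKernel 0 p q
        = ((2 * √Real.pi
            * Heisenberg.follandG (Heisenberg.mul (Heisenberg.inv q) p) : ℝ) : ℂ)) ∧
    -- the integral representation of `G`
    (∀ (z : Fin n → ℂ) (τ : ℝ), z ≠ 0 →
      IntegrableOn (fun x : ℝ => (x : ℂ) ^ (n - 1)
          * (Real.exp (-(x * Heisenberg.sqNorm z)) : ℂ)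
          * Heisenberg.tricomiPsi ((n : ℂ) / 2) n (2 * x * Heisenberg.sqNorm z)
          * (Real.cos (τ * x) : ℂ)) (Ioi (0 : ℝ)) ∧
      (Heisenberg.follandG (z, τ) : ℂ)
        = ((Real.pi ^ (-(n : ℝ) - 1) * 2 ^ ((n : ℝ) - 1) * Real.Gamma ((n : ℝ) / 2) : ℝ) : ℂ)
          * ∫ x in Ioi (0 : ℝ), (x : ℂ) ^ (n - 1)
              * (Real.exp (-(x * Heisenberg.sqNorm z)) : ℂ)
              * Heisenberg.tricomiPsi ((n : ℂ) / 2) n (2 * x * Heisenberg.sqNorm z)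
              * (Real.cos (τ * x) : ℂ)) := by
  have hc := Heisenberg.follandConst_eq hn
  have hc0 := Heisenberg.follandConst_pos hn
  have hpi := Real.pi_pos
  refine ⟨hc, fun φ hφ hφc => ?_, fun p q hpq => ?_, fun z τ hz => ?_⟩
  · simp only [Heisenberg.subLaplacian_mul_follandG]
    refine ⟨(Heisenberg.integrable_mul_regPow_zero hn
      (Heisenberg.contDiff_subLaplacian hφ).continuous
      (Heisenberg.hasCompactSupport_subLaplacian hφc)).const_mul _, ?_⟩
    rw [integral_const_mul, Heisenberg.integral_subLaplacian_mul_regPow_zero hn hφ hφc,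
      mul_left_comm, ← Complex.ofReal_mul, mul_inv_cancel₀ hc0.ne', Complex.ofReal_one, mul_one]
  · refine ⟨fun ζ hζ => Heisenberg.integrableOn_resolventIntegrand hn hζ hpq,
      Heisenberg.tendsto_resolventKernel hn hpq, Heisenberg.neg_resolventKernel_zero hn hpq, ?_, ?_⟩
    · rw [Heisenberg.neg_resolventKernel_zero hn hpq, Heisenberg.follandG_mul_inv]
      congr 1
      field_simp
    · have hs := Real.sqrt_pos.2 hpi
      have hd := Real.rpow_pos_of_pos hpi ((n : ℝ) + 1 / 2)
      have hpow : Real.pi ^ ((n : ℝ) + 1) = Real.pi ^ ((n : ℝ) + 1 / 2) * √Real.pi := by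
        rw [Real.sqrt_eq_rpow, ← Real.rpow_add hpi]; congr 1; ring
      rw [Heisenberg.neg_resolventKernel_zero hn hpq, Heisenberg.follandG_mul_inv, hc, hpow,
        show (n : ℝ) - 1 = (n - 2) + 1 by ring, Real.rpow_add_one two_ne_zero]
      congr 1
      generalize Real.pi ^ ((n : ℝ) + 1 / 2) = A at hd
      field_simp
  · obtain ⟨h1, h2⟩ := Heisenberg.integrableOn_follandIntegrand hn hz τ
    refine ⟨h1, ?_⟩
    rw [Complex.ofReal_mul, mul_assoc, h2, ← Complex.ofReal_mul, Heisenberg.follandG_eq,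
      Heisenberg.regGauge_zero, hc, show -(n : ℝ) - 1 = -((n : ℝ) + 1) by ring,
      Real.rpow_neg hpi.le, show (n : ℝ) - 1 = (n - 2) + 1 by ring, Real.rpow_add_one two_ne_zero]
    congr 1
    ring
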